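/- Let $p$ be a prime number and let $X$ be a compact 3-manifold (topological, Hausdorff, possibly with boundary). Let $(X_{p^n}\to X)_{n\ge 0}$ be a $\mathbb{Z}_p$-cover of $X$, that is, a system of connected regular covers $X_{p^n}\to X$ with covering group $\mathbb{Z}/p^n\mathbb{Z}$ which is compatible in the sense that for every $n$ the map $X_{p^{n+1}}\to X$ factors through $X_{p^n}\to X$. For each $n$, let $H_1(X_{p^n})$ be the first singular homology group with coefficients in $\mathbb{Z}$, let $H_1(X_{p^n})_{\rm tor}$ be its torsion subgroup, let $H_1(X_{p^n})_{\text{non-}p}$ be the subgroup of elements of finite order prime to $p$, and for a prime number $l$ let $H_1(X_{p^n})_{(l)}$ be the subgroup of elements of $l$-power order. Then all these subgroups are finite, and, as $n\to\infty$, each of the sequences of orders $(|H_1(X_{p^n})_{\rm tor}|)_n$, $(|H_1(X_{p^n})_{\text{non-}p}|)_n$ and, for every prime number $l$ (including $l=p$), $(|H_1(X_{p^n})_{(l)}|)_n$ converges in the ring $\mathbb{Z}_p$ of $p$-adic integers. -/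

import Mathlib

open Filter Topology

universe u

/-- A `ℤ_p`-cover of a space `X`: a compatible system of connected regular covers `X_{p^n} → X`
with group `ℤ/p^n`, for `n ≥ 0`. Regularity with the given group says that `ℤ/p^n` acts freely and
properly discontinuously on `X_{p^n}` and that the projection is the quotient map.
Compatibility says that `X_{p^{n+1}} → X` factors through `X_{p^n} → X`; as the covers are
connected, the factoring maps are then automatically equivariant along some surjection
`ℤ/p^{n+1} → ℤ/p^n`, so that no compatibility of the chosen generators has to be required. -/
structure ZpCover (p : ℕ) (X : Type u) [TopologicalSpace X] where
  /-- the `n`-th layer `X_{p^n}` -/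
  space : ℕ → TopCat.{u}
  connected : ∀ n, ConnectedSpace (space n)
  /-- the covering projection `X_{p^n} → X` -/
  proj : ∀ n, C(space n, X)
  /-- the action of the covering group -/
  action : ∀ n, AddAction (ZMod (p ^ n)) (space n)
  isCover : ∀ n, IsAddQuotientCoveringMap (proj n) (ZMod (p ^ n))
  /-- the transition maps `X_{p^{n+1}} → X_{p^n}` -/
  trans : ∀ n, C(space (n + 1), space n)
  proj_trans : ∀ n, (proj n).comp (trans n) = proj (n + 1)

/-- The first singular homology group `H_1(Y; ℤ)`. -/
noncomputable abbrev H1 (Y : TopCat.{u}) : ModuleCat.{u} ℤ :=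
  ((AlgebraicTopology.singularHomologyFunctor (ModuleCat.{u} ℤ) 1).obj
    (ModuleCat.of ℤ (ULift.{u} ℤ))).obj Y

/-- The non-`p` torsion subgroup: the elements of finite order prime to `p`
(for `p ≠ 1`, elements of infinite order have `addOrderOf x = 0` and are excluded). -/
def nonPTorsion (A : Type u) [AddCommGroup A] (p : ℕ) : AddSubgroup A where
  carrier := {x | (addOrderOf x).Coprime p}
  zero_mem' := by simp
  add_mem' {x y} hx hy :=
    (Nat.Coprime.mul_left hx hy).coprime_dvd_left
      (AddCommute.addOrderOf_add_dvd_mul_addOrderOf (AddCommute.all x y))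
  neg_mem' {x} hx := by simpa using hx

/-! First homology does not pass to coinvariants along a covering, but singular `1`-chains modulo
boundaries do: paths and triangles lift, uniquely up to deck transformations
(`EdgeGroup.map_eq_zero_iff_of_covering`). As `0`-chains are torsion-free, this larger group has the
same torsion as `H_1` (`exists_H1_to_edgeGroup`). It is far from finitely generated. Lifting a fixed
system of paths in `X` to a base point cuts out, compatibly with all maps, the summand of classes
with boundary over that point, in effect `H_1` relative to the fibre; compactness and convex charts
make it finitely generated. This gives finitely generated groups `D n` with automorphisms `t n`
satisfying `t n ^ p ^ n = 1`, such that `D n` is the quotient of `D (n + 1)` by the image of `t (n +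
1) ^ p ^ n - 1`. The rest is algebra (`tower_torsion_converges`).

For torsion prime to `p`, a norm argument identifies the torsion of `D n` with the elements of the
torsion of `D (n + 1)` fixed by the subgroup of order `p`. All other elements lie in orbits of
length exactly `p ^ (n + 1)`, so consecutive orders agree modulo `p ^ (n + 1)`
(`card_killedBy_modEq`).

For `p`-torsion, the modules `ℤ_p ⊗ D n` are the quotients `E / ω n` of one Noetherian module over
the Iwasawa algebra (`exists_noetherian_limit`). Once a finite submodule is divided out,
multiplication by `ν n = ω (n + 1) / ω n` is injective for large `n` and embeds each layer in the
next (`exists_card_primaryComponent_le`). Hence the orders are powers of `p` that eventually do not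
decrease: they stabilise or tend to `0` in `ℤ_p`. The whole torsion is the product of the two parts.
-/

/-! ### Orbit counting and the torsion prime to `p` -/

/-- If every point has exact period `p ^ (n + 1)` under a permutation, then this number divides the
number of points. -/
theorem Equiv.Perm.prime_pow_dvd_card {p : ℕ} [Fact p.Prime] {n : ℕ} {α : Type*} [Finite α]
    (σ : Equiv.Perm α) (h1 : σ ^ p ^ (n + 1) = 1) (h2 : ∀ x, (σ ^ p ^ n) x ≠ x) :
    p ^ (n + 1) ∣ Nat.card α := by
  classical
  cases nonempty_fintype α
  have key : ∀ x : α, Nat.card (MulAction.orbit (Subgroup.zpowers σ) x) = p ^ (n + 1) := by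
    intro x
    rw [Nat.card_eq_fintype_card, ← MulAction.minimalPeriod_eq_card]
    refine Function.minimalPeriod_eq_prime_pow (fun h => h2 x ?_) ?_
    · have h' : (σ : α → α)^[p ^ n] x = x := h
      rwa [Equiv.Perm.iterate_eq_pow] at h'
    · change (σ : α → α)^[p ^ (n + 1)] x = x
      rw [Equiv.Perm.iterate_eq_pow, h1, Equiv.Perm.one_apply]
  rw [Nat.card_congr (MulAction.selfEquivSigmaOrbits (Subgroup.zpowers σ) α), Nat.card_sigma]
  exact Finset.dvd_sum fun ω _ => by rw [key]

/-- The elements killed by some integer with a given property. -/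
def killedBy (P : ℕ → Prop) (M : Type*) [AddCommGroup M] : Set M :=
  {x | ∃ m, P m ∧ m • x = 0}

section Coinvariants

variable {p : ℕ} [Fact p.Prime] {n : ℕ} {M M' : Type*} [AddCommGroup M] [AddCommGroup M']
  (t : AddMonoid.End M) (π : M →+ M') (P : ℕ → Prop)

theorem mapsTo_killedBy (f : M →+ M') : Set.MapsTo f (killedBy P M) (killedBy P M') := by
  rintro x ⟨m, hm, hx⟩
  exact ⟨m, hm, by rw [← map_nsmul, hx, map_zero]⟩

-- The norm `N = 1 + s + ⋯ + s ^ (p - 1)` acts as `p` on fixed elements and satisfies `π ∘ N = p •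
-- π`. A fixed element of `ker π` has the form `s y - y`, so `N`, and hence `p`, kills it; being
-- killed by an integer prime to `p` as well, it vanishes. Conversely `N` of any lift of an element
-- killed by `m` is fixed and killed by `m`, and `p` is invertible modulo `m`.
omit [Fact p.Prime] in
theorem bijOn_fixed_killedBy (s : AddMonoid.End M) (hs : s ^ p = 1)
    (hπ : Function.Surjective π) (hker : ∀ x, π x = 0 ↔ ∃ y, x = s y - y)
    (hP : ∀ m, P m → m.Coprime p) :
    Set.BijOn π {x ∈ killedBy P M | s x = x} (killedBy P M') := by
  set N : M →+ M := ∑ i ∈ Finset.range p, (s ^ i : AddMonoid.End M) with hN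
  have hNapp : ∀ x, N x = ∑ i ∈ Finset.range p, (s ^ i : AddMonoid.End M) x := fun x =>
    AddMonoidHom.finsetSum_apply (fun i => (s ^ i : AddMonoid.End M)) (Finset.range p) x
  have hNs : ∀ x, N (s x) = N x := by
    intro x
    rw [hNapp, hNapp, ← sub_eq_zero, ← Finset.sum_sub_distrib]
    have : ∀ i, (s ^ i : AddMonoid.End M) (s x) = (s ^ (i + 1) : AddMonoid.End M) x := fun i => by
      rw [pow_succ]; rfl
    simp_rw [this]
    rw [Finset.sum_range_sub (fun i => (s ^ i : AddMonoid.End M) x), hs, pow_zero, sub_self]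
  have hsN : ∀ x, s (N x) = N x := by
    intro x
    refine Eq.trans ?_ (hNs x)
    rw [hNapp, hNapp, map_sum]
    refine Finset.sum_congr rfl fun i _ => ?_
    change (s * s ^ i) x = (s ^ i * s) x
    rw [← pow_succ, ← pow_succ']
  have hfix : ∀ x, s x = x → N x = p • x := by
    intro x hx
    have : ∀ i, (s ^ i : AddMonoid.End M) x = x := fun i => by
      induction i with
      | zero => rfl
      | succ i ih => rw [pow_succ]; change (s ^ i) (s x) = x; rw [hx, ih]
    rw [hNapp]; simp [this]
  have hπs : ∀ x, π (s x) = π x := fun x => by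
    rw [← sub_eq_zero, ← map_sub, hker]; exact ⟨x, rfl⟩
  have hπN : ∀ x, π (N x) = p • π x := by
    intro x
    have : ∀ i, π ((s ^ i : AddMonoid.End M) x) = π x := fun i => by
      induction i with
      | zero => rfl
      | succ i ih => rw [pow_succ', ← ih]; exact hπs _
    rw [hNapp, map_sum, Finset.sum_congr rfl fun i _ => this i, Finset.sum_const, Finset.card_range]
  refine ⟨fun x hx => mapsTo_killedBy P π hx.1, ?_, ?_⟩
  · suffices ∀ z, s z = z → (∃ m : ℕ, m.Coprime p ∧ m • z = 0) → π z = 0 → z = 0 by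
      rintro x ⟨⟨m, hm, hx⟩, hsx⟩ y ⟨⟨m', hm', hy⟩, hsy⟩ hxy
      rw [← sub_eq_zero]
      refine this _ (by rw [map_sub, hsx, hsy])
        ⟨m * m', Nat.Coprime.mul_left (hP m hm) (hP m' hm'), ?_⟩ (by rw [map_sub, hxy, sub_self])
      rw [nsmul_sub, mul_nsmul, hx, mul_nsmul', hy]
      simp
    rintro z hz ⟨m, hm, hmz⟩ hπz
    obtain ⟨y, rfl⟩ := (hker z).1 hπz
    have hp0 : p • (s y - y) = 0 := by
      rw [← hfix _ hz, map_sub, hNs, sub_self]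
    have h1 := addOrderOf_dvd_of_nsmul_eq_zero hp0
    have h2 := addOrderOf_dvd_of_nsmul_eq_zero hmz
    have := Nat.eq_one_of_dvd_coprimes hm h2 h1
    exact AddMonoid.addOrderOf_eq_one_iff.1 this
  · rintro x' ⟨m, hm, hx'⟩
    obtain ⟨x, rfl⟩ := hπ x'
    have hmx : m • N x = 0 := by
      obtain ⟨y, hy⟩ := (hker (m • x)).1 (by rw [map_nsmul, hx'])
      rw [← map_nsmul, hy, map_sub, hNs, sub_self]
    obtain ⟨a, b, hab⟩ : ∃ a b : ℤ, a * p + b * m = 1 := by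
      have := (Nat.isCoprime_iff_coprime.2 (hP m hm)).symm
      exact this
    refine ⟨a • N x, ⟨⟨m, hm, ?_⟩, ?_⟩, ?_⟩
    · rw [smul_comm, hmx, smul_zero]
    · rw [map_zsmul, hsN]
    · rw [map_zsmul, hπN]
      have : (a * p + b * m) • π x = π x := by rw [hab, one_smul]
      rw [add_smul, mul_smul, mul_smul] at this
      simpa [hx'] using this

/-- Let `t` generate an action of `ℤ/p^(n+1)` on `M`, and let `M'` be the coinvariants of the
subgroup of order `p`. Then the prime-to-`p` torsion of `M` and `M'` have congruent orders. -/
theorem card_killedBy_modEq (ht : t ^ p ^ (n + 1) = 1)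
    (hπ : Function.Surjective π) (hker : ∀ x, π x = 0 ↔ ∃ y, x = (t ^ p ^ n) y - y)
    (hP : ∀ m, P m → m.Coprime p) [Finite (killedBy P M)] :
    Nat.card (killedBy P M) ≡ Nat.card (killedBy P M') [MOD p ^ (n + 1)] := by
  classical
  set W := killedBy P M
  set s : AddMonoid.End M := t ^ p ^ n with hsdef
  have hs : s ^ p = 1 := by rw [hsdef, ← pow_mul, ← pow_succ, ht]
  have hbij := bijOn_fixed_killedBy π P s hs hπ hker hP
  -- `A` accounts for the torsion of `M'`; on the complement `B` every `t`-orbit has full length.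
  set A := {x ∈ W | s x = x} with hA
  set B := {x ∈ W | s x ≠ x} with hB
  have hAW : A ∪ B = W := by ext x; simp only [hA, hB, Set.mem_union, Set.mem_ofPred_eq]; tauto
  have hAB : Disjoint A B := by
    rw [Set.disjoint_left]; rintro x ⟨_, h⟩ ⟨_, h'⟩; exact h' h
  have hWf : W.Finite := Set.toFinite W
  have hAf : A.Finite := hWf.subset fun x hx => hx.1
  have hBf : B.Finite := hWf.subset fun x hx => hx.1
  have hcard : Nat.card W = Nat.card (killedBy P M') + Nat.card B := by
    rw [Nat.card_congr (Set.BijOn.equiv π hbij).symm]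
    simp only [Nat.card_coe_set_eq]
    rw [← hAW, Set.ncard_union_eq hAB hAf hBf]
  have hBdvd : p ^ (n + 1) ∣ Nat.card B := by
    have := hBf.to_subtype
    have hpos : 0 < p ^ (n + 1) := pow_pos (Fact.out (p := p.Prime)).pos _
    set t' : AddMonoid.End M := t ^ (p ^ (n + 1) - 1)
    have h1 : t * t' = 1 := by rw [← pow_succ', Nat.sub_add_cancel hpos, ht]
    have h2 : t' * t = 1 := by rw [← pow_succ, Nat.sub_add_cancel hpos, ht]
    have hmem : ∀ i : ℕ, ∀ x ∈ B, (t ^ i) x ∈ B := by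
      rintro i x ⟨hx, hsx⟩
      refine ⟨mapsTo_killedBy P (t ^ i : AddMonoid.End M) hx, fun h => hsx ?_⟩
      have hcomm : s ((t ^ i) x) = (t ^ i) (s x) := by
        change (s * t ^ i) x = (t ^ i * s) x
        rw [hsdef, ← pow_add, ← pow_add, add_comm]
      rw [hcomm] at h
      have hinj : Function.Injective (t ^ i : AddMonoid.End M) := by
        have : t' ^ i * t ^ i = 1 := by
          have hc : Commute t' t := by rw [Commute, SemiconjBy, h1, h2]
          rw [← hc.mul_pow, h2, one_pow]
        intro a b hab
        have := congrArg (t' ^ i) hab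
        change (t' ^ i * t ^ i) a = (t' ^ i * t ^ i) b at this
        rwa [‹t' ^ i * t ^ i = 1›] at this
      exact hinj h
    let σ : Equiv.Perm B :=
      { toFun := fun x => ⟨t x, by simpa using hmem 1 x x.2⟩
        invFun := fun x => ⟨t' x, hmem _ x x.2⟩
        left_inv := fun x => Subtype.ext (congrArg (fun f : AddMonoid.End M => f x) h2)
        right_inv := fun x => Subtype.ext (congrArg (fun f : AddMonoid.End M => f x) h1) }
    have hσ : ∀ i : ℕ, ∀ x : B, ((σ ^ i) x : M) = (t ^ i) x := by
      intro i
      induction i with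
      | zero => intro x; rfl
      | succ i ih => intro x; rw [pow_succ, pow_succ, Equiv.Perm.mul_apply, ih]; rfl
    refine Equiv.Perm.prime_pow_dvd_card σ ?_ ?_
    · ext x
      rw [hσ, ht]; rfl
    · intro x hx
      exact x.2.2 (by rw [hsdef, ← hσ, hx])
  rw [hcard]
  have : Nat.card B ≡ 0 [MOD p ^ (n + 1)] := (Nat.modEq_zero_iff_dvd).2 hBdvd
  simpa using (Nat.ModEq.refl (Nat.card (killedBy P M'))).add this

end Coinvariants

/-! ### Two criteria for `p`-adic convergence -/

theorem PadicInt.exists_tendsto_of_modEq {p : ℕ} [Fact p.Prime] (a : ℕ → ℕ)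
    (h : ∀ n, a (n + 1) ≡ a n [MOD p ^ (n + 1)]) :
    ∃ x : ℤ_[p], Tendsto (fun n => (a n : ℤ_[p])) atTop (𝓝 x) := by
  have hp : 1 < (p : ℝ) := by exact_mod_cast (Fact.out (p := p.Prime)).one_lt
  refine cauchySeq_tendsto_of_complete (cauchySeq_of_le_geometric (p : ℝ)⁻¹ 1
    (inv_lt_one_of_one_lt₀ hp) fun n => ?_)
  -- The congruence modulo `p ^ n` already gives the geometric bound with constant `1`.
  have h1 : ((p ^ n : ℕ) : ℤ) ∣ (a n : ℤ) - a (n + 1) := by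
    have := (Nat.modEq_iff_dvd.1 (h n))
    exact (Int.natCast_dvd_natCast.2 (pow_dvd_pow p n.le_succ)).trans this
  have h2 : ‖(((a n : ℤ) - a (n + 1) : ℤ) : ℤ_[p])‖ ≤ (p : ℝ) ^ (-n : ℤ) := by
    rw [PadicInt.norm_int_le_pow_iff_dvd]; exact_mod_cast h1
  rw [dist_eq_norm]
  push_cast at h2
  simpa using h2

/-- Powers of `p` with eventually monotone values converge `p`-adically. -/
theorem PadicInt.exists_tendsto_of_eventually_monotone {p : ℕ} [Fact p.Prime] (a : ℕ → ℕ) (N : ℕ)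
    (hpow : ∀ n, ∃ k, a n = p ^ k) (hmono : ∀ n ≥ N, a n ≤ a (n + 1)) :
    ∃ x : ℤ_[p], Tendsto (fun n => (a n : ℤ_[p])) atTop (𝓝 x) := by
  have hp := (Fact.out (p := p.Prime))
  choose e he using hpow
  have hm : Monotone fun n => e (n + N) := monotone_nat_of_le_succ fun n => by
    have := hmono (n + N) (by omega)
    rw [he, he] at this
    have := (Nat.pow_le_pow_iff_right hp.one_lt).1 this
    rwa [show n + 1 + N = n + N + 1 by omega]
  simp_rw [he, Nat.cast_pow]
  -- Bounded exponents are eventually constant; unbounded ones force the limit `0`.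
  by_cases hb : BddAbove (Set.range fun n => e (n + N))
  · have := tendsto_atTop_ciSup hm hb
    refine ⟨(p : ℤ_[p]) ^ (⨆ n, e (n + N)), (tendsto_add_atTop_iff_nat N).1 ?_⟩
    exact ((continuous_of_discreteTopology (f := fun k : ℕ => (p : ℤ_[p]) ^ k)).tendsto _).comp this
  · have h1 : Tendsto (fun n => e (n + N)) atTop atTop :=
      tendsto_atTop_atTop_of_monotone hm fun b => by
        by_contra! hcon
        exact hb ⟨b, by rintro _ ⟨n, rfl⟩; exact (hcon n).le⟩
    refine ⟨0, (tendsto_add_atTop_iff_nat N).1 ?_⟩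
    have h2 : Tendsto (fun k : ℕ => (p : ℤ_[p]) ^ k) atTop (𝓝 0) :=
      tendsto_pow_atTop_nhds_zero_of_norm_lt_one (by
        rw [PadicInt.norm_p]
        exact inv_lt_one_of_one_lt₀ (by exact_mod_cast hp.one_lt))
    exact h2.comp h1

/-! ### Layers of a Noetherian module -/

section NoetherianTower

open scoped Pointwise

variable {Λ : Type*} [CommRing Λ]

theorem Module.finite_of_isTorsionBySet_of_finite_quotient {M : Type*} [AddCommGroup M] [Module Λ M]
    [Module.Finite Λ M] (I : Ideal Λ) [Finite (Λ ⧸ I)] (h : Module.IsTorsionBySet Λ M I) :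
    Finite M := by
  let := h.module
  have : IsScalarTower Λ (Λ ⧸ I) M := h.isScalarTower
  have : Module.Finite (Λ ⧸ I) M := Module.Finite.of_restrictScalars_finite Λ (Λ ⧸ I) M
  exact Module.finite_of_finite (Λ ⧸ I)

variable {E : Type*} [AddCommGroup E] [Module Λ E] [IsNoetherian Λ E]
  {p : ℕ} {ω ν : ℕ → Λ}

/-- In a Noetherian module, the annihilators of the `ν n` eventually lie in one finite
submodule. -/
theorem exists_kernel_bound (hω : ∀ n, ω (n + 1) = ω n * ν n) (hν : ∀ n, ω n ∣ ν n - p) :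
    ∃ k, ∀ n ≥ k, ∀ x : E, ν n • x = 0 → ω k • x = 0 ∧ (p : Λ) • x = 0 := by
  have hmono : Monotone fun n => Submodule.torsionBy Λ E (ω n) :=
    monotone_nat_of_le_succ fun n x hx => by
      rw [Submodule.mem_torsionBy_iff] at hx ⊢
      rw [hω, mul_comm, mul_smul, hx, smul_zero]
  obtain ⟨k, hk⟩ := monotone_stabilizes_iff_noetherian.2 ‹_› ⟨_, hmono⟩
  refine ⟨k, fun n hn x hx => ?_⟩
  have h1 : x ∈ Submodule.torsionBy Λ E (ω (n + 1)) := by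
    rw [Submodule.mem_torsionBy_iff, hω, mul_smul, hx, smul_zero]
  have h2 : Submodule.torsionBy Λ E (ω (n + 1)) = Submodule.torsionBy Λ E (ω k) :=
    (hk (n + 1) (by omega)).symm
  have h3 : Submodule.torsionBy Λ E (ω n) = Submodule.torsionBy Λ E (ω k) := (hk n hn).symm
  have h4 : ω n • x = 0 := by
    rw [← Submodule.mem_torsionBy_iff, h3, ← h2]; exact h1
  refine ⟨by rw [← Submodule.mem_torsionBy_iff, ← h2]; exact h1, ?_⟩
  -- Modulo `ω n`, which now kills `x`, the element `ν n` is congruent to `p`.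
  obtain ⟨c, hc⟩ := hν n
  have : (p : Λ) = ν n - c * ω n := by rw [mul_comm c, ← hc]; ring
  rw [this, sub_smul, hx, mul_smul, h4, smul_zero, sub_zero]

/-- The intersection is a finitely generated module over the finite ring `Λ / (a, b)`. -/
theorem finite_torsion_inf (a b : Λ) [Finite (Λ ⧸ Ideal.span {a, b})] :
    Finite (Submodule.torsionBy Λ E a ⊓ Submodule.torsionBy Λ E b : Submodule Λ E) := by
  refine Module.finite_of_isTorsionBySet_of_finite_quotient (Ideal.span {a, b}) ?_
  rw [Module.isTorsionBySet_iff_subset_annihilator]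
  change Ideal.span {a, b} ≤ _
  rw [Ideal.span_le]
  rintro c (rfl | rfl)
  · rw [SetLike.mem_coe, Module.mem_annihilator]
    rintro ⟨x, hx⟩
    exact Subtype.ext hx.1
  · rw [SetLike.mem_coe, Module.mem_annihilator]
    rintro ⟨x, hx⟩
    exact Subtype.ext hx.2

variable (Λ E p) in
/-- There is a largest finite submodule annihilated by a power of `p`. -/
theorem exists_maximal_finite_torsion : ∃ E₀ : Submodule Λ E, Finite E₀ ∧
    (∃ j : ℕ, ∀ x ∈ E₀, (p ^ j) • x = 0) ∧
    ∀ N : Submodule Λ (E ⧸ E₀), Finite N → (∀ x ∈ N, p • x = 0) → N = ⊥ := by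
  obtain ⟨E₀, ⟨hfin, j, hj⟩, hmax⟩ := set_has_maximal_iff_noetherian.2 ‹IsNoetherian Λ E›
    {N | Finite N ∧ ∃ j : ℕ, ∀ x ∈ N, (p ^ j) • x = 0}
    ⟨⊥, inferInstance, 0, by rintro x hx; rw [(Submodule.mem_bot Λ).1 hx, smul_zero]⟩
  refine ⟨E₀, hfin, ⟨j, hj⟩, fun N hN hpN => ?_⟩
  set N' := N.comap E₀.mkQ with hN'
  have hle : E₀ ≤ N' := by
    intro x hx
    rw [hN', Submodule.mem_comap, Submodule.mkQ_apply, (Submodule.Quotient.mk_eq_zero _).2 hx]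
    exact N.zero_mem
  -- Fibres of the projection are cosets of the finite `E₀`, so the preimage of the finite `N` is
  -- finite; it is killed by `p ^ (j + 1)`, so maximality of `E₀` applies.
  have hfin' : Finite N' := by
    have : (N' : Set E) = E₀.mkQ ⁻¹' (N : Set (E ⧸ E₀)) := rfl
    have hf : (N' : Set E).Finite := by
      rw [this]
      refine Set.Finite.preimage' (Set.toFinite _) fun b _ => ?_
      obtain ⟨a, rfl⟩ := E₀.mkQ_surjective b
      refine (((Set.toFinite (E₀ : Set E)).image (fun e => a + e))).subset fun x hx => ?_
      refine ⟨x - a, ?_, add_sub_cancel _ _⟩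
      exact (Submodule.Quotient.eq _).1 hx
    exact hf
  have hnlt := hmax N' ⟨hfin', j + 1, fun x hx => by
    rw [pow_succ, mul_smul]
    apply hj
    rw [← Submodule.Quotient.mk_eq_zero, Submodule.Quotient.mk_smul]
    exact hpN _ hx⟩
  have heq : E₀ = N' := by
    by_contra hne
    exact hnlt (lt_of_le_of_ne hle hne)
  rw [eq_bot_iff]
  intro y hy
  obtain ⟨x, rfl⟩ := E₀.mkQ_surjective y
  have : x ∈ E₀ := by rw [heq]; exact hy
  exact (Submodule.Quotient.mk_eq_zero _).2 this

omit [IsNoetherian Λ E] in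
theorem mem_smul_top_iff (a : Λ) (x : E) : x ∈ a • (⊤ : Submodule Λ E) ↔ ∃ y, a • y = x := by
  constructor
  · intro h
    obtain ⟨y, -, hy⟩ := h
    exact ⟨y, hy⟩
  · rintro ⟨y, rfl⟩
    exact Submodule.smul_mem_pointwise_smul y a ⊤ trivial

omit [IsNoetherian Λ E] in
/-- If `ν n` acts injectively, multiplication by it embeds the `p`-primary part of `E / ω n` into
that of `E / ω (n + 1)`. -/
theorem card_primaryComponent_le_of_injective (hω : ∀ n, ω (n + 1) = ω n * ν n) (n : ℕ)
    (hinj : ∀ x : E, ν n • x = 0 → x = 0)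
    [Finite (AddCommGroup.primaryComponent (E ⧸ ω (n + 1) • (⊤ : Submodule Λ E)) p)] :
    Nat.card (AddCommGroup.primaryComponent (E ⧸ ω n • (⊤ : Submodule Λ E)) p) ≤
    Nat.card (AddCommGroup.primaryComponent (E ⧸ ω (n + 1) • (⊤ : Submodule Λ E)) p) := by
  let f : (E ⧸ ω n • (⊤ : Submodule Λ E)) →ₗ[Λ] (E ⧸ ω (n + 1) • (⊤ : Submodule Λ E)) :=
    Submodule.mapQ _ _ (LinearMap.lsmul Λ E (ν n)) (by
      intro x hx
      obtain ⟨y, rfl⟩ := (mem_smul_top_iff _ _).1 hx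
      rw [Submodule.mem_comap, mem_smul_top_iff]
      exact ⟨y, by rw [hω, mul_comm, mul_smul]; rfl⟩)
  have hf : Function.Injective f := by
    rw [injective_iff_map_eq_zero]
    intro a ha
    obtain ⟨x, rfl⟩ := Submodule.mkQ_surjective _ a
    rw [Submodule.mkQ_apply, Submodule.mapQ_apply, Submodule.Quotient.mk_eq_zero,
      mem_smul_top_iff] at ha
    obtain ⟨y, hy⟩ := ha
    have h0 : ν n • (ω n • y - x) = 0 := by
      rw [smul_sub, ← mul_smul, mul_comm, ← hω, hy]
      exact sub_self _
    rw [Submodule.mkQ_apply, Submodule.Quotient.mk_eq_zero, mem_smul_top_iff]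
    exact ⟨y, sub_eq_zero.1 (hinj _ h0)⟩
  refine Nat.card_le_card_of_injective
    (fun a => ⟨f a, ?_⟩) fun a b hab => Subtype.ext (hf (congrArg Subtype.val hab))
  obtain ⟨k, hk⟩ := a.2
  exact ⟨k, by rw [← map_nsmul, hk, map_zero]⟩

-- As `E₀` meets `a • E` trivially, it is the kernel of `E / a → (E / E₀) / a`. It is killed by `p ^
-- j`, so any lift of an element killed by `p ^ k` is killed by `p ^ (k + j)`: the sequence stays
-- exact on `p`-primary parts.
omit [IsNoetherian Λ E] in
theorem card_primaryComponent_quotient (E₀ : Submodule Λ E)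
    {j : ℕ} (hj : ∀ x ∈ E₀, (p ^ j) • x = 0) (a : Λ)
    (hdisj : ∀ x ∈ E₀, x ∈ a • (⊤ : Submodule Λ E) → x = 0) :
    Nat.card (AddCommGroup.primaryComponent (E ⧸ a • (⊤ : Submodule Λ E)) p) = Nat.card E₀ *
    Nat.card (AddCommGroup.primaryComponent ((E ⧸ E₀) ⧸ a • (⊤ : Submodule Λ (E ⧸ E₀))) p) := by
  let q : (E ⧸ a • (⊤ : Submodule Λ E)) →ₗ[Λ] ((E ⧸ E₀) ⧸ a • (⊤ : Submodule Λ (E ⧸ E₀))) :=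
    Submodule.mapQ _ _ E₀.mkQ (by
      intro x hx
      obtain ⟨y, rfl⟩ := (mem_smul_top_iff _ _).1 hx
      rw [Submodule.mem_comap, mem_smul_top_iff]
      exact ⟨E₀.mkQ y, by rw [map_smul]⟩)
  have hq : ∀ x : E, q (Submodule.Quotient.mk x) = 0 ↔
      ∃ e ∈ E₀, (Submodule.Quotient.mk x : E ⧸ a • (⊤ : Submodule Λ E)) =
        Submodule.Quotient.mk e := by
    intro x
    rw [Submodule.mapQ_apply, Submodule.Quotient.mk_eq_zero, mem_smul_top_iff]
    constructor
    · rintro ⟨y, hy⟩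
      obtain ⟨y, rfl⟩ := E₀.mkQ_surjective y
      rw [← map_smul, ← sub_eq_zero, ← map_sub, Submodule.mkQ_apply,
        Submodule.Quotient.mk_eq_zero] at hy
      refine ⟨x - a • y, by rw [← neg_mem_iff, neg_sub]; exact hy, ?_⟩
      rw [Submodule.Quotient.eq, mem_smul_top_iff]
      exact ⟨y, by abel⟩
    · rintro ⟨e, he, hxe⟩
      rw [Submodule.Quotient.eq, mem_smul_top_iff] at hxe
      obtain ⟨y, hy⟩ := hxe
      refine ⟨E₀.mkQ y, ?_⟩
      rw [← map_smul, hy, map_sub, Submodule.mkQ_apply, Submodule.mkQ_apply,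
        (Submodule.Quotient.mk_eq_zero _).2 he, sub_zero]
  let T := AddCommGroup.primaryComponent (E ⧸ a • (⊤ : Submodule Λ E)) p
  let T' := AddCommGroup.primaryComponent ((E ⧸ E₀) ⧸ a • (⊤ : Submodule Λ (E ⧸ E₀))) p
  let g : T →+ T' := (q.toAddMonoidHom.comp T.subtype).codRestrict T' (by
    rintro ⟨x, k, hk⟩
    exact ⟨k, by rw [← map_nsmul]; exact (congrArg q hk).trans (map_zero q)⟩)
  have hg : Function.Surjective g := by
    rintro ⟨y, k, hk⟩
    obtain ⟨y, rfl⟩ := Submodule.mkQ_surjective _ y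
    obtain ⟨y, rfl⟩ := E₀.mkQ_surjective y
    refine ⟨⟨Submodule.Quotient.mk y, k + j, ?_⟩, rfl⟩
    have : q (Submodule.Quotient.mk (p ^ k • y)) = 0 := hk
    obtain ⟨e, he, hye⟩ := (hq _).1 this
    rw [pow_add, mul_comm, mul_smul, ← Submodule.Quotient.mk_smul, hye,
      ← Submodule.Quotient.mk_smul, hj e he, Submodule.Quotient.mk_zero]
  have hker : Nat.card g.ker = Nat.card E₀ := by
    symm
    refine Nat.card_congr (Equiv.ofBijective (fun e => ⟨⟨Submodule.Quotient.mk (e : E), j, ?_⟩, ?_⟩)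
      ⟨?_, ?_⟩)
    · rw [← Submodule.Quotient.mk_smul, hj e e.2, Submodule.Quotient.mk_zero]
    · exact Subtype.ext ((hq _).2 ⟨e, e.2, rfl⟩)
    · intro e e' h
      have h' := (Submodule.Quotient.eq _).1 (congrArg (fun z => z.1.1) h)
      exact Subtype.ext (sub_eq_zero.1 (hdisj _ (E₀.sub_mem e.2 e'.2) h'))
    · rintro ⟨⟨x, hx⟩, hgx⟩
      obtain ⟨x, rfl⟩ := Submodule.mkQ_surjective _ x
      obtain ⟨e, he, hxe⟩ := (hq x).1 (congrArg Subtype.val hgx)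
      exact ⟨⟨e, he⟩, Subtype.ext (Subtype.ext hxe.symm)⟩
  have h1 := AddSubgroup.card_mul_index g.ker
  rw [AddSubgroup.index_ker, AddMonoidHom.range_eq_top.2 hg] at h1
  change Nat.card T = _ * Nat.card T'
  rw [← h1, hker]
  simp

/-- The orders of the `p`-primary parts of the layers of a Noetherian module in a cyclic `p`-tower
are eventually nondecreasing. -/
theorem exists_card_primaryComponent_le (hω : ∀ n, ω (n + 1) = ω n * ν n)
    (hν : ∀ n, ω n ∣ ν n - p) (hfin : ∀ n, Finite (Λ ⧸ Ideal.span {ω n, (p : Λ)}))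
    (hsep : ∀ x : E, (∀ n, x ∈ ω n • (⊤ : Submodule Λ E)) → x = 0)
    (hT : ∀ n, Finite (AddCommGroup.primaryComponent (E ⧸ ω n • (⊤ : Submodule Λ E)) p)) :
    ∃ N, ∀ n ≥ N, Nat.card (AddCommGroup.primaryComponent (E ⧸ ω n • (⊤ : Submodule Λ E)) p) ≤
      Nat.card (AddCommGroup.primaryComponent (E ⧸ ω (n + 1) • (⊤ : Submodule Λ E)) p) := by
  obtain ⟨E₀, hE₀, ⟨j, hj⟩, hmax⟩ := exists_maximal_finite_torsion Λ E p
  obtain ⟨k, hk⟩ := exists_kernel_bound (E := E ⧸ E₀) hω hν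
  have hanti : ∀ m n, m ≤ n → ∀ x : E, x ∈ ω n • (⊤ : Submodule Λ E) →
      x ∈ ω m • (⊤ : Submodule Λ E) := by
    intro m n hmn
    induction n, hmn using Nat.le_induction with
    | base => exact fun x hx => hx
    | succ n _ ih =>
      intro x hx
      obtain ⟨y, rfl⟩ := (mem_smul_top_iff _ _).1 hx
      exact ih _ ((mem_smul_top_iff _ _).2 ⟨ν n • y, by rw [hω, mul_smul]⟩)
  -- The submodules `ω n • E` decrease to zero, so they eventually avoid the finitely many nonzero
  -- elements of `E₀`.
  have hdisj : ∃ M, ∀ n ≥ M, ∀ x ∈ E₀, x ∈ ω n • (⊤ : Submodule Λ E) → x = 0 := by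
    have : ∀ x : E₀, ∃ M, (x : E) ∈ ω M • (⊤ : Submodule Λ E) → (x : E) = 0 := by
      intro x
      by_contra! hcon
      exact (hcon 0).2 (hsep x fun n => (hcon n).1)
    choose M hM using this
    obtain ⟨B, hB⟩ := (Set.finite_range M).bddAbove
    exact ⟨B, fun n hn x hx hxn => hM ⟨x, hx⟩ (hanti _ n ((hB ⟨_, rfl⟩).trans hn) x hxn)⟩
  obtain ⟨M, hM⟩ := hdisj
  refine ⟨max M k, fun n hn => ?_⟩
  have hn1 : M ≤ n := (le_max_left _ _).trans hn
  have hn2 : k ≤ n := (le_max_right _ _).trans hn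
  have c1 := card_primaryComponent_quotient (p := p) E₀ hj (ω n) (hM n hn1)
  have c2 := card_primaryComponent_quotient (p := p) E₀ hj (ω (n + 1)) (hM (n + 1) (by omega))
  rw [c1, c2]
  -- Finiteness is inherited through the product formula, since an infinite type has `Nat.card`
  -- equal to `0`.
  have hpos : Nat.card (AddCommGroup.primaryComponent (E ⧸ ω (n + 1) • (⊤ : Submodule Λ E)) p) ≠
      0 := Nat.card_pos.ne'
  have : Finite (AddCommGroup.primaryComponent
      ((E ⧸ E₀) ⧸ ω (n + 1) • (⊤ : Submodule Λ (E ⧸ E₀))) p) := by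
    refine Nat.finite_of_card_ne_zero fun h => hpos ?_
    rw [c2, h, mul_zero]
  refine Nat.mul_le_mul_left _ (card_primaryComponent_le_of_injective hω n fun x hx => ?_)
  have hfin' := hfin k
  -- For `n ≥ k` the kernel of `ν n` on `E / E₀` lies in this finite submodule killed by `p`, which
  -- is zero by the choice of `E₀`.
  have hbot := hmax (Submodule.torsionBy Λ (E ⧸ E₀) (ω k) ⊓ Submodule.torsionBy Λ (E ⧸ E₀) (p : Λ))
    (finite_torsion_inf _ _) (fun y hy => by
      have := hy.2
      rw [SetLike.mem_coe, Submodule.mem_torsionBy_iff] at this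
      rwa [Nat.cast_smul_eq_nsmul] at this)
  have hx' : x ∈ (Submodule.torsionBy Λ (E ⧸ E₀) (ω k) ⊓
      Submodule.torsionBy Λ (E ⧸ E₀) (p : Λ)) := hk n hn2 x hx
  rw [hbot] at hx'
  exact hx'

end NoetherianTower

/-! ### The Iwasawa algebra and its elements `ω n`, `ν n` -/

section IwasawaAlgebra

open scoped Pointwise PowerSeries.WithPiTopology

open PowerSeries

variable {p : ℕ} [Fact p.Prime]

variable (p) in
/-- The element `(1 + X) ^ (p ^ n) - 1` of the Iwasawa algebra. -/
noncomputable def iwasawaOmega (n : ℕ) : ℤ_[p]⟦X⟧ := (1 + X) ^ p ^ n - 1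

variable (p) in
/-- The quotient of two consecutive elements `(1 + X) ^ (p ^ n) - 1`. -/
noncomputable def iwasawaNu (n : ℕ) : ℤ_[p]⟦X⟧ := ∑ i ∈ Finset.range p, ((1 + X) ^ p ^ n) ^ i

theorem iwasawaOmega_zero : iwasawaOmega p 0 = X := by simp [iwasawaOmega]

theorem iwasawaOmega_succ (n : ℕ) :
    iwasawaOmega p (n + 1) = iwasawaOmega p n * iwasawaNu p n := by
  rw [iwasawaOmega, iwasawaOmega, iwasawaNu, mul_geom_sum, ← pow_mul, ← pow_succ]

theorem iwasawaOmega_dvd_nu_sub (n : ℕ) : iwasawaOmega p n ∣ iwasawaNu p n - p := by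
  have : iwasawaNu p n - p = ∑ i ∈ Finset.range p, (((1 + X) ^ p ^ n) ^ i - 1) := by
    rw [Finset.sum_sub_distrib, iwasawaNu]; simp
  rw [this]
  exact Finset.dvd_sum fun i _ => sub_one_dvd_pow_sub_one _ i

theorem iwasawaOmega_dvd {m n : ℕ} (h : m ≤ n) : iwasawaOmega p m ∣ iwasawaOmega p n := by
  induction n, h using Nat.le_induction with
  | base => rfl
  | succ n _ ih => exact ih.trans ⟨_, iwasawaOmega_succ n⟩

variable (p) in
/-- The polynomial `(1 + X) ^ (p ^ n) - 1`. -/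
noncomputable def iwasawaPoly (n : ℕ) : Polynomial ℤ_[p] := (1 + Polynomial.X) ^ p ^ n - 1

theorem coe_iwasawaPoly (n : ℕ) : (iwasawaPoly p n : ℤ_[p]⟦X⟧) = iwasawaOmega p n := by
  simp [iwasawaPoly, iwasawaOmega]

theorem natDegree_iwasawaPoly_aux (n : ℕ) :
    ((1 + Polynomial.X : Polynomial ℤ_[p]) ^ p ^ n).natDegree = p ^ n := by
  rw [Polynomial.natDegree_pow, add_comm, ← Polynomial.C_1, Polynomial.natDegree_X_add_C, mul_one]

theorem iwasawaPoly_monic (n : ℕ) : (iwasawaPoly p n).Monic := by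
  have h : ((1 + Polynomial.X : Polynomial ℤ_[p]) ^ p ^ n).Monic := by
    refine Polynomial.Monic.pow ?_ _
    rw [add_comm, ← Polynomial.C_1]; exact Polynomial.monic_X_add_C 1
  refine Polynomial.Monic.sub_of_left h ?_
  rw [Polynomial.degree_one, Polynomial.degree_eq_natDegree h.ne_zero, natDegree_iwasawaPoly_aux]
  exact_mod_cast pow_pos (Fact.out (p := p.Prime)).pos n

theorem natDegree_iwasawaPoly (n : ℕ) : (iwasawaPoly p n).natDegree = p ^ n := by
  rw [iwasawaPoly, ← Polynomial.C_1, Polynomial.natDegree_sub_C, Polynomial.C_1,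
    natDegree_iwasawaPoly_aux]

/-- Modulo `p` the polynomial becomes `X ^ p ^ n`, by Frobenius. Weierstrass division by it is what
reduces power series to polynomials below. -/
theorem iwasawaPoly_isDistinguishedAt (n : ℕ) :
    (iwasawaPoly p n).IsDistinguishedAt (IsLocalRing.maximalIdeal ℤ_[p]) where
  monic := iwasawaPoly_monic n
  mem := by
    intro k hk
    rw [natDegree_iwasawaPoly] at hk
    rw [← PadicInt.ker_toZMod, RingHom.mem_ker, ← Polynomial.coeff_map,
      iwasawaPoly, Polynomial.map_sub, Polynomial.map_pow, Polynomial.map_add,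
      Polynomial.map_one, Polynomial.map_X, add_pow_char_pow, one_pow, add_sub_cancel_left,
      Polynomial.coeff_X_pow, if_neg hk.ne]

/-- The quotient of the Iwasawa algebra by `(1 + X) ^ (p ^ n) - 1` is a quotient of the polynomial
ring. -/
noncomputable def iwasawaQuotientEquiv (n : ℕ) :
    (Polynomial ℤ_[p] ⧸ Ideal.span {iwasawaPoly p n}) ≃ₐ[ℤ_[p]]
      ℤ_[p]⟦X⟧ ⧸ Ideal.span {(iwasawaPoly p n : ℤ_[p]⟦X⟧)} :=
  (iwasawaPoly_isDistinguishedAt n).algEquivQuotient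

/-- Since the polynomial is monic, the quotient by `ω n` is finitely generated over `ℤ_p`; the
further quotient is killed by `p`, and `ℤ_p / p` is finite. -/
theorem finite_quotient_iwasawaOmega_p (n : ℕ) :
    Finite (ℤ_[p]⟦X⟧ ⧸ Ideal.span {iwasawaOmega p n, (p : ℤ_[p]⟦X⟧)}) := by
  have : Module.Finite ℤ_[p] (Polynomial ℤ_[p] ⧸ Ideal.span {iwasawaPoly p n}) :=
    (iwasawaPoly_monic n).finite_quotient
  have h1 : Module.Finite ℤ_[p] (ℤ_[p]⟦X⟧ ⧸ Ideal.span {(iwasawaPoly p n : ℤ_[p]⟦X⟧)}) :=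
    Module.Finite.equiv (iwasawaQuotientEquiv n).toLinearEquiv
  have hle : Ideal.span {(iwasawaPoly p n : ℤ_[p]⟦X⟧)} ≤
      Ideal.span {iwasawaOmega p n, (p : ℤ_[p]⟦X⟧)} := by
    rw [coe_iwasawaPoly]; exact Ideal.span_mono (by simp)
  have h2 : Module.Finite ℤ_[p] (ℤ_[p]⟦X⟧ ⧸ Ideal.span {iwasawaOmega p n, (p : ℤ_[p]⟦X⟧)}) :=
    Module.Finite.of_surjective (Ideal.Quotient.factorₐ ℤ_[p] hle).toLinearMap
      (Ideal.Quotient.factor_surjective hle)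
  have h3 : Finite (ℤ_[p] ⧸ Ideal.span {(p : ℤ_[p])}) := by
    rw [← PadicInt.maximalIdeal_eq_span_p]
    exact Finite.of_equiv (ZMod p) PadicInt.residueField.symm.toEquiv
  refine Module.finite_of_isTorsionBySet_of_finite_quotient (Ideal.span {(p : ℤ_[p])}) ?_
  rw [Module.isTorsionBySet_span_singleton_iff]
  intro x
  obtain ⟨x, rfl⟩ := Ideal.Quotient.mk_surjective x
  rw [Nat.cast_smul_eq_nsmul, nsmul_eq_mul, ← map_natCast (Ideal.Quotient.mk _), ← map_mul,
    Ideal.Quotient.eq_zero_iff_mem]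
  exact Ideal.mul_mem_right _ _ (Ideal.subset_span (by simp))

/-- By Noetherianity the submodule is the image of a finite power of the compact ring `ℤ_p⟦X⟧` under
a continuous map. -/
theorem isClosed_submodule_powerSeries {d : ℕ} (N : Submodule ℤ_[p]⟦X⟧ (Fin d → ℤ_[p]⟦X⟧)) :
    IsClosed (N : Set (Fin d → ℤ_[p]⟦X⟧)) := by
  have hc : CompactSpace ℤ_[p]⟦X⟧ := inferInstanceAs (CompactSpace ((Unit →₀ ℕ) → ℤ_[p]))
  have : T2Space ℤ_[p]⟦X⟧ := inferInstance
  obtain ⟨k, g, hg⟩ := Submodule.fg_iff_exists_fin_generating_family.1 (IsNoetherian.noetherian N)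
  have : (N : Set (Fin d → ℤ_[p]⟦X⟧)) =
      Set.range fun c : Fin k → ℤ_[p]⟦X⟧ => ∑ i, c i • g i := by
    ext x
    rw [SetLike.mem_coe, ← hg, Submodule.mem_span_range_iff_exists_fun]
    rfl
  rw [this]
  exact (isCompact_range (by fun_prop)).isClosed

/-! ### A Noetherian module behind a tower -/

section InverseLimit

variable {E : ℕ → Type*} [∀ n, AddCommGroup (E n)] [∀ n, Module ℤ_[p]⟦X⟧ (E n)]
  [∀ n, Module.Finite ℤ_[p]⟦X⟧ (E n)] (π : ∀ n, E (n + 1) →ₗ[ℤ_[p]⟦X⟧] E n)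

/-- Nakayama: the kernel of `f` lies in `X • M`, so `N + X • M = M`, and `X` is in the maximal
ideal. -/
theorem span_eq_top_of_map_eq_top {M M' : Type*} [AddCommGroup M] [AddCommGroup M']
    [Module ℤ_[p]⟦X⟧ M] [Module ℤ_[p]⟦X⟧ M'] [Module.Finite ℤ_[p]⟦X⟧ M]
    (f : M →ₗ[ℤ_[p]⟦X⟧] M') (hker : ∀ x, f x = 0 → ∃ y, x = (X : ℤ_[p]⟦X⟧) • y)
    (N : Submodule ℤ_[p]⟦X⟧ M) (hN : N.map f = ⊤) : N = ⊤ := by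
  rw [eq_top_iff]
  refine Submodule.le_of_le_smul_of_le_jacobson_bot (I := Ideal.span {X})
    Module.Finite.fg_top ?_ ?_
  · rw [Ideal.span_le, Set.singleton_subset_iff, SetLike.mem_coe,
      IsLocalRing.jacobson_eq_maximalIdeal _ bot_ne_top, IsLocalRing.mem_maximalIdeal,
      mem_nonunits_iff, PowerSeries.isUnit_iff_constantCoeff]
    simp
  · intro x _
    have : f x ∈ N.map f := by rw [hN]; trivial
    obtain ⟨y, hy, hyx⟩ := this
    obtain ⟨z, hz⟩ := hker (x - y) (by rw [map_sub, hyx, sub_self])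
    rw [← sub_add_cancel x y, hz, add_comm]
    exact Submodule.add_mem_sup hy
      (Submodule.smul_mem_smul (Ideal.mem_span_singleton_self _) trivial)

include π in
/-- A tower of finite modules over the Iwasawa algebra, each layer being the reduction of the next
one, comes from a Noetherian module. -/
theorem exists_noetherian_limit (hπ : ∀ n, Function.Surjective (π n))
    (hω : ∀ n, ∀ x : E n, iwasawaOmega p n • x = 0)
    (hker : ∀ n, ∀ x, π n x = 0 → ∃ y, x = iwasawaOmega p n • y) :
    ∃ (d : ℕ) (K : Submodule ℤ_[p]⟦X⟧ (Fin d → ℤ_[p]⟦X⟧)),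
      (∀ x : (Fin d → ℤ_[p]⟦X⟧) ⧸ K, (∀ n, x ∈ iwasawaOmega p n •
        (⊤ : Submodule ℤ_[p]⟦X⟧ ((Fin d → ℤ_[p]⟦X⟧) ⧸ K))) → x = 0) ∧
      ∀ n, Nonempty ((((Fin d → ℤ_[p]⟦X⟧) ⧸ K) ⧸ iwasawaOmega p n •
        (⊤ : Submodule ℤ_[p]⟦X⟧ ((Fin d → ℤ_[p]⟦X⟧) ⧸ K))) ≃ₗ[ℤ_[p]⟦X⟧] E n) := by
  obtain ⟨d, x₀, hx₀⟩ := Submodule.fg_iff_exists_fin_generating_family.1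
    (Module.Finite.fg_top : (⊤ : Submodule ℤ_[p]⟦X⟧ (E 0)).FG)
  -- Generators of `E 0` are lifted compatibly up the tower; by Nakayama the lifts generate every
  -- layer, so `d` does not grow.
  let x : ∀ n, Fin d → E n := fun n =>
    Nat.rec x₀ (fun n y i => Function.surjInv (hπ n) (y i)) n
  have hx : ∀ n i, π n (x (n + 1) i) = x n i := fun n i => Function.surjInv_eq (hπ n) _
  let φ : ∀ n, (Fin d → ℤ_[p]⟦X⟧) →ₗ[ℤ_[p]⟦X⟧] E n := fun n =>
    Fintype.linearCombination ℤ_[p]⟦X⟧ (x n)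
  have hφπ : ∀ n f, π n (φ (n + 1) f) = φ n f := by
    intro n f
    simp only [φ, Fintype.linearCombination_apply, map_sum, map_smul, hx]
  have hrange : ∀ n, LinearMap.range (φ n) = ⊤ := by
    intro n
    induction n with
    | zero => rw [Fintype.range_linearCombination]; exact hx₀
    | succ n ih =>
      refine span_eq_top_of_map_eq_top (π n) (fun y hy => ?_) _ ?_
      · obtain ⟨z, rfl⟩ := hker n y hy
        obtain ⟨c, hc⟩ := iwasawaOmega_dvd (p := p) (Nat.zero_le n)
        rw [iwasawaOmega_zero] at hc
        exact ⟨c • z, by rw [hc, mul_smul]⟩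
      · rw [← LinearMap.range_comp, ← ih]
        congr 1
        ext1 f
        exact LinearMap.ext fun g => hφπ n _
  have hsurj : ∀ n, Function.Surjective (φ n) := fun n => LinearMap.range_eq_top.1 (hrange n)
  have hanti : ∀ n m, n ≤ m → LinearMap.ker (φ m) ≤ LinearMap.ker (φ n) := by
    intro n m h
    induction m, h using Nat.le_induction with
    | base => exact le_rfl
    | succ m _ ih =>
      refine le_trans (fun f hf => ?_) ih
      rw [LinearMap.mem_ker] at hf ⊢
      rw [← hφπ, hf, map_zero]
  -- At each further level the remaining error is a multiple of `ω m`, hence of `ω n`, and is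
  -- absorbed into `g`.
  have hlift : ∀ n m, n ≤ m → ∀ f ∈ LinearMap.ker (φ n),
      ∃ g, f - iwasawaOmega p n • g ∈ LinearMap.ker (φ m) := by
    intro n m h
    induction m, h using Nat.le_induction with
    | base =>
      intro f hf
      exact ⟨0, by simpa using hf⟩
    | succ m hm ih =>
      intro f hf
      obtain ⟨g, hg⟩ := ih f hf
      rw [LinearMap.mem_ker, ← hφπ] at hg
      obtain ⟨e, he⟩ := hker m _ hg
      obtain ⟨g', rfl⟩ := hsurj _ e
      obtain ⟨c, hc⟩ := iwasawaOmega_dvd (p := p) hm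
      refine ⟨g + c • g', ?_⟩
      rw [LinearMap.mem_ker, smul_add, ← mul_smul, ← hc, ← sub_sub, map_sub, he, map_smul, sub_self]
  set K : Submodule ℤ_[p]⟦X⟧ (Fin d → ℤ_[p]⟦X⟧) := ⨅ n, LinearMap.ker (φ n) with hK
  have hKmem : ∀ f, f ∈ K ↔ ∀ n, φ n f = 0 := fun f => by simp [hK]
  have hcompact : ∀ n, ∀ f ∈ LinearMap.ker (φ n), ∃ g, f - iwasawaOmega p n • g ∈ K := by
    intro n f hf
    have hc : CompactSpace ℤ_[p]⟦X⟧ := inferInstanceAs (CompactSpace ((Unit →₀ ℕ) → ℤ_[p]))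
    -- The corrections that work up to level `n + k` form decreasing nonempty closed sets in a
    -- compact space, so one correction works at all levels.
    let S : ℕ → Set (Fin d → ℤ_[p]⟦X⟧) := fun k =>
      {g | f - iwasawaOmega p n • g ∈ LinearMap.ker (φ (n + k))}
    have hclosed : ∀ k, IsClosed (S k) := fun k =>
      (isClosed_submodule_powerSeries (LinearMap.ker (φ (n + k)))).preimage
        (f := fun g => f - iwasawaOmega p n • g) (by fun_prop)
    obtain ⟨g, hg⟩ := IsCompact.nonempty_iInter_of_sequence_nonempty_isCompact_isClosed S
      (fun k g hg => hanti _ _ (by omega) hg) (fun k => hlift n (n + k) (by omega) f hf)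
      (hclosed 0).isCompact hclosed
    refine ⟨g, (hKmem _).2 fun m => ?_⟩
    have hm : f - iwasawaOmega p n • g ∈ LinearMap.ker (φ (n + m)) := Set.mem_iInter.1 hg m
    exact hanti m (n + m) (by omega) hm
  let ψ : ∀ n, ((Fin d → ℤ_[p]⟦X⟧) ⧸ K) →ₗ[ℤ_[p]⟦X⟧] E n := fun n =>
    K.liftQ (φ n) (iInf_le _ n)
  have hψker : ∀ n, LinearMap.ker (ψ n) = iwasawaOmega p n •
      (⊤ : Submodule ℤ_[p]⟦X⟧ ((Fin d → ℤ_[p]⟦X⟧) ⧸ K)) := by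
    intro n
    ext y
    obtain ⟨f, rfl⟩ := K.mkQ_surjective y
    rw [LinearMap.mem_ker, mem_smul_top_iff]
    constructor
    · intro hf
      obtain ⟨g, hg⟩ := hcompact n f hf
      refine ⟨K.mkQ g, ?_⟩
      rw [← map_smul, eq_comm, ← sub_eq_zero, ← map_sub]
      exact (Submodule.Quotient.mk_eq_zero _).2 hg
    · rintro ⟨z, hz⟩
      rw [← hz, map_smul, hω]
  have hψsurj : ∀ n, Function.Surjective (ψ n) := fun n e => by
    obtain ⟨f, rfl⟩ := hsurj n e
    exact ⟨K.mkQ f, rfl⟩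
  refine ⟨d, K, fun y hy => ?_, fun n => ⟨?_⟩⟩
  · obtain ⟨f, rfl⟩ := K.mkQ_surjective y
    refine (Submodule.Quotient.mk_eq_zero _).2 ((hKmem f).2 fun n => ?_)
    have := hy n
    rw [← hψker] at this
    exact this
  · exact (Submodule.quotEquivOfEq _ _ (hψker n).symm).trans
      ((ψ n).quotKerEquivOfSurjective (hψsurj n))

include π in
/-- The orders of the `p`-primary parts in such a tower are eventually nondecreasing. -/
theorem exists_card_primaryComponent_le_of_tower (hπ : ∀ n, Function.Surjective (π n))
    (hω : ∀ n, ∀ x : E n, iwasawaOmega p n • x = 0)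
    (hker : ∀ n, ∀ x, π n x = 0 → ∃ y, x = iwasawaOmega p n • y)
    (hT : ∀ n, Finite (AddCommGroup.primaryComponent (E n) p)) :
    ∃ N, ∀ n ≥ N, Nat.card (AddCommGroup.primaryComponent (E n) p) ≤
      Nat.card (AddCommGroup.primaryComponent (E (n + 1)) p) := by
  obtain ⟨d, K, hsep, e⟩ := exists_noetherian_limit π hπ hω hker
  have equiv : ∀ n, Nonempty (AddCommGroup.primaryComponent (((Fin d → ℤ_[p]⟦X⟧) ⧸ K) ⧸
      iwasawaOmega p n • (⊤ : Submodule ℤ_[p]⟦X⟧ ((Fin d → ℤ_[p]⟦X⟧) ⧸ K))) p ≃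
      AddCommGroup.primaryComponent (E n) p) := fun n => by
    obtain ⟨f⟩ := e n
    refine ⟨f.toEquiv.subtypeEquiv fun x => ?_⟩
    refine exists_congr fun k => ?_
    rw [← map_eq_zero_iff f f.injective, map_nsmul]
    rfl
  have hT' := fun n => Finite.of_equiv _ (equiv n).some.symm
  obtain ⟨N, hN⟩ := exists_card_primaryComponent_le (p := p) iwasawaOmega_succ
    iwasawaOmega_dvd_nu_sub finite_quotient_iwasawaOmega_p hsep hT'
  refine ⟨N, fun n hn => ?_⟩
  rw [← Nat.card_congr (equiv n).some, ← Nat.card_congr (equiv (n + 1)).some]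
  exact hN n hn

end InverseLimit

end IwasawaAlgebra

/-! ### The action of the Iwasawa algebra defined by an automorphism of `p`-power order -/

section IwasawaAction

open scoped TensorProduct

open PowerSeries

variable {p : ℕ} [Fact p.Prime] {M M' : Type*} [AddCommGroup M] [Module ℤ_[p] M]
  [AddCommGroup M'] [Module ℤ_[p] M']

/-- An endomorphism `t` with `t ^ (p ^ n) = 1` defines an action of the Iwasawa algebra, in which
`X` acts as `t - 1`. -/
noncomputable def iwasawaAction (n : ℕ) (t : Module.End ℤ_[p] M) (ht : t ^ p ^ n = 1) :
    ℤ_[p]⟦X⟧ →+* Module.End ℤ_[p] M :=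
  ((Ideal.Quotient.lift (Ideal.span {iwasawaPoly p n})
    (Polynomial.aeval (t - 1) : Polynomial ℤ_[p] →ₐ[ℤ_[p]] Module.End ℤ_[p] M).toRingHom (by
      intro a ha
      obtain ⟨b, rfl⟩ := Ideal.mem_span_singleton'.1 ha
      simp [iwasawaPoly, ht])).comp
    (iwasawaQuotientEquiv n).symm.toAlgHom.toRingHom).comp
    (Ideal.Quotient.mk (Ideal.span {(iwasawaPoly p n : ℤ_[p]⟦X⟧)}))

theorem iwasawaAction_coe (n : ℕ) (t : Module.End ℤ_[p] M) (ht : t ^ p ^ n = 1)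
    (g : Polynomial ℤ_[p]) :
    iwasawaAction n t ht (g : ℤ_[p]⟦X⟧) = Polynomial.aeval (t - 1) g := by
  have h : (iwasawaQuotientEquiv (p := p) n).symm
      (Ideal.Quotient.mk (Ideal.span {(iwasawaPoly p n : ℤ_[p]⟦X⟧)}) (g : ℤ_[p]⟦X⟧)) =
      Ideal.Quotient.mk _ g := by
    rw [AlgEquiv.symm_apply_eq]
    simp [iwasawaQuotientEquiv]
  rw [iwasawaAction, RingHom.comp_apply, RingHom.comp_apply]
  refine Eq.trans (congrArg _ h) ?_
  rfl

theorem iwasawaAction_omega (n : ℕ) (t : Module.End ℤ_[p] M) (ht : t ^ p ^ n = 1) (m : ℕ) :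
    iwasawaAction n t ht (iwasawaOmega p m) = t ^ p ^ m - 1 := by
  rw [← coe_iwasawaPoly, iwasawaAction_coe]
  simp [iwasawaPoly]

theorem exists_polynomial_sub_mem (n : ℕ) (a : ℤ_[p]⟦X⟧) :
    ∃ g : Polynomial ℤ_[p], ∃ b, a = g + b * iwasawaOmega p n := by
  obtain ⟨g, hg⟩ := (iwasawaQuotientEquiv n).surjective
    (Ideal.Quotient.mk (Ideal.span {(iwasawaPoly p n : ℤ_[p]⟦X⟧)}) a)
  obtain ⟨g, rfl⟩ := Ideal.Quotient.mk_surjective g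
  have : Ideal.Quotient.mk (Ideal.span {(iwasawaPoly p n : ℤ_[p]⟦X⟧)}) (g : ℤ_[p]⟦X⟧) =
      Ideal.Quotient.mk _ a := by
    rw [← hg]; simp [iwasawaQuotientEquiv]
  rw [eq_comm, Ideal.Quotient.eq, Ideal.mem_span_singleton', coe_iwasawaPoly] at this
  obtain ⟨b, hb⟩ := this
  exact ⟨g, b, by rw [hb]; ring⟩

/-- Modulo `ω m` every power series is a polynomial, and `ω m` acts as zero on both sides because `n
≤ m`. This reduces the claim to polynomials in `t - 1`. -/
theorem map_iwasawaAction {m n : ℕ} (hmn : n ≤ m) (t : Module.End ℤ_[p] M) (ht : t ^ p ^ m = 1)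
    (t' : Module.End ℤ_[p] M') (ht' : t' ^ p ^ n = 1) (f : M →ₗ[ℤ_[p]] M')
    (hf : ∀ x, f (t x) = t' (f x)) (a : ℤ_[p]⟦X⟧) (x : M) :
    f (iwasawaAction m t ht a x) = iwasawaAction n t' ht' a (f x) := by
  obtain ⟨g, b, rfl⟩ := exists_polynomial_sub_mem m a
  have h0 : t' ^ p ^ m = 1 := by
    obtain ⟨k, rfl⟩ := Nat.exists_eq_add_of_le hmn
    rw [pow_add, pow_mul, ht', one_pow]
  rw [map_add, map_mul, iwasawaAction_omega, ht, sub_self, mul_zero, add_zero, map_add, map_mul,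
    iwasawaAction_omega, h0, sub_self, mul_zero, add_zero, iwasawaAction_coe, iwasawaAction_coe]
  have hf' : ∀ x, f ((t - 1) x) = (t' - 1) (f x) := fun x => by simp [hf]
  induction g using Polynomial.induction_on generalizing x with
  | C a => simp
  | add g₁ g₂ h₁ h₂ => simp [h₁, h₂]
  | monomial k a h =>
    rw [pow_succ, ← mul_assoc, map_mul (Polynomial.aeval (t - 1)) _ Polynomial.X,
      map_mul (Polynomial.aeval (t' - 1)) _ Polynomial.X, Polynomial.aeval_X, Polynomial.aeval_X,
      Module.End.mul_apply, Module.End.mul_apply, h, hf']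

end IwasawaAction

/-! ### Extension of scalars to `ℤ_p` -/

section BaseChange

open scoped TensorProduct

variable {p : ℕ} [Fact p.Prime]

theorem PadicInt.exists_eq_natCast_add (k : ℕ) (a : ℤ_[p]) :
    ∃ (m : ℕ) (b : ℤ_[p]), a = m + p ^ k * b := by
  have h := PadicInt.appr_spec k a
  obtain ⟨b, hb⟩ := Ideal.mem_span_singleton'.1 h
  exact ⟨a.appr k, b, by rw [mul_comm, hb]; ring⟩

/-- On a group killed by `p ^ k` only `ℤ_p / p ^ k = ℤ / p ^ k` matters: reduction modulo `p ^ k`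
gives a left inverse, and approximating scalars by natural numbers gives surjectivity. -/
theorem bijective_one_tmul_of_pow_smul (k : ℕ) {B : Type*} [AddCommGroup B]
    (hB : ∀ b : B, p ^ k • b = 0) :
    Function.Bijective fun b : B => (1 : ℤ_[p]) ⊗ₜ[ℤ] b := by
  constructor
  · let : Module (ZMod (p ^ k)) B := AddCommGroup.zmodModule hB
    let g : ℤ_[p] ⊗[ℤ] B →ₗ[ℤ] B := TensorProduct.lift
      { toFun := fun a =>
          { toFun := fun b => PadicInt.toZModPow k a • b
            map_add' := smul_add _
            map_smul' := fun m b => by rw [smul_comm]; rfl }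
        map_add' := fun a a' => by ext b; simp [add_smul]
        map_smul' := fun m a => by ext b; simp [mul_smul, Int.cast_smul_eq_zsmul] }
    intro b b' h
    have hg : ∀ b, g (1 ⊗ₜ b) = b := fun b => by
      change PadicInt.toZModPow k (1 : ℤ_[p]) • b = b
      rw [map_one, one_smul]
    rw [← hg b, ← hg b']
    exact congrArg g h
  · intro z
    induction z using TensorProduct.induction_on with
    | zero => exact ⟨0, TensorProduct.tmul_zero _ _⟩
    | add x y hx hy =>
      obtain ⟨b, rfl⟩ := hx
      obtain ⟨b', rfl⟩ := hy
      exact ⟨b + b', TensorProduct.tmul_add _ _ _⟩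
    | tmul a b =>
      obtain ⟨m, c, rfl⟩ := PadicInt.exists_eq_natCast_add k a
      refine ⟨m • b, ?_⟩
      have h1 : ((p : ℤ_[p]) ^ k * c) ⊗ₜ[ℤ] b = 0 := by
        have : ((p : ℤ_[p]) ^ k * c) = (p ^ k : ℕ) • c := by simp
        rw [this, TensorProduct.smul_tmul, hB, TensorProduct.tmul_zero]
      have h2 : (m : ℤ_[p]) ⊗ₜ[ℤ] b = (1 : ℤ_[p]) ⊗ₜ[ℤ] (m • b) := by
        rw [← TensorProduct.smul_tmul]; simp
      simp only [TensorProduct.add_tmul, h1, h2, add_zero]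

/-- Extending scalars to `ℤ_p` does not change the `p`-primary component. -/
theorem nonempty_primaryComponent_equiv (D : Type*) [AddCommGroup D] :
    Nonempty (AddCommGroup.primaryComponent D p ≃
      AddCommGroup.primaryComponent (ℤ_[p] ⊗[ℤ] D) p) := by
  have hflat : Module.Flat ℤ ℤ_[p] := inferInstance
  have hmul : ∀ (k : ℕ) (z : ℤ_[p] ⊗[ℤ] D),
      LinearMap.lTensor ℤ_[p] (LinearMap.lsmul ℤ D (p ^ k : ℤ)) z = (p ^ k : ℤ) • z := by
    intro k z
    induction z using TensorProduct.induction_on with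
    | zero => simp
    | add x y hx hy => rw [map_add, hx, hy, smul_add]
    | tmul a b => simp
  -- By flatness the `p ^ k`-torsion of `ℤ_p ⊗ D` comes from `ℤ_p ⊗ D[p ^ k]`, which is `D[p ^ k]`
  -- itself.
  have key : ∀ k : ℕ, ∀ z : ℤ_[p] ⊗[ℤ] D, p ^ k • z = 0 →
      ∃ b : Submodule.torsionBy ℤ D (p ^ k : ℤ), z = 1 ⊗ₜ (b : D) := by
    intro k z hz
    have hex : Function.Exact (Submodule.torsionBy ℤ D (p ^ k : ℤ)).subtype
        (LinearMap.lsmul ℤ D (p ^ k : ℤ)) := by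
      intro x
      simp
    have := Module.Flat.lTensor_exact ℤ_[p] hex
    obtain ⟨w, rfl⟩ := (this z).1 (by
      rw [hmul]; exact_mod_cast hz)
    obtain ⟨b, rfl⟩ := (bijective_one_tmul_of_pow_smul (p := p) k
      (B := Submodule.torsionBy ℤ D (p ^ k : ℤ)) (fun b => by
        have := Submodule.smul_torsionBy (p ^ k : ℤ) b
        exact_mod_cast this)).2 w
    exact ⟨b, rfl⟩
  have hinj : ∀ k : ℕ, ∀ x : D, p ^ k • x = 0 → (1 : ℤ_[p]) ⊗ₜ[ℤ] x = 0 → x = 0 := by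
    intro k x hx h0
    let b : Submodule.torsionBy ℤ D (p ^ k : ℤ) := ⟨x, by simpa using (by exact_mod_cast hx)⟩
    have h1 : (1 : ℤ_[p]) ⊗ₜ[ℤ] b = 0 := by
      apply Module.Flat.lTensor_preserves_injective_linearMap (M := ℤ_[p])
        (Submodule.torsionBy ℤ D (p ^ k : ℤ)).subtype (Submodule.injective_subtype _)
      simpa [b] using h0
    have h2 := (bijective_one_tmul_of_pow_smul (p := p) k
      (B := Submodule.torsionBy ℤ D (p ^ k : ℤ)) (fun b => by
        have := Submodule.smul_torsionBy (p ^ k : ℤ) b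
        exact_mod_cast this)).1 (a₁ := b) (a₂ := 0) (by simpa using h1)
    exact congrArg Subtype.val h2
  refine ⟨Equiv.ofBijective (fun x => ⟨1 ⊗ₜ (x : D), ?_⟩) ⟨?_, ?_⟩⟩
  · obtain ⟨k, hk⟩ := x.2
    exact ⟨k, by rw [← TensorProduct.tmul_smul, hk, TensorProduct.tmul_zero]⟩
  · intro x y h
    have h' : (1 : ℤ_[p]) ⊗ₜ[ℤ] ((x - y : AddCommGroup.primaryComponent D p) : D) = 0 := by
      rw [AddSubgroup.coe_sub, TensorProduct.tmul_sub, sub_eq_zero]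
      exact congrArg Subtype.val h
    obtain ⟨k, hk⟩ := (x - y).2
    exact sub_eq_zero.1 (Subtype.ext (hinj k _ hk h'))
  · rintro ⟨z, k, hz⟩
    obtain ⟨⟨b, hb⟩, rfl⟩ := key k z hz
    refine ⟨⟨b, k, ?_⟩, rfl⟩
    rw [Submodule.mem_torsionBy_iff] at hb
    exact_mod_cast hb

end BaseChange

/-! ### Convergence for towers of finitely generated groups -/

section Tower

open scoped TensorProduct

open PowerSeries

variable {p : ℕ} [Fact p.Prime] {D : ℕ → Type*} [∀ n, AddCommGroup (D n)]
  [∀ n, Module.Finite ℤ (D n)] (t : ∀ n, AddMonoid.End (D n)) (π : ∀ n, D (n + 1) →+ D n)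

instance finite_torsion_of_finite (A : Type*) [AddCommGroup A] [Module.Finite ℤ A] :
    Finite (AddCommGroup.torsion A) := by
  have h : Module.Finite ℤ (Submodule.torsion ℤ A) := inferInstance
  have h2 : Finite (Submodule.torsion ℤ A) :=
    Module.finite_of_fg_torsion _ (Submodule.torsion_isTorsion)
  refine Finite.of_injective (fun x : AddCommGroup.torsion A =>
    (⟨x, ?_⟩ : Submodule.torsion ℤ A)) fun x y hxy => Subtype.ext (Subtype.mk.inj hxy)
  obtain ⟨n, hn, hx⟩ := (isOfFinAddOrder_iff_nsmul_eq_zero).1 x.2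
  exact ⟨⟨n, by simpa using hn.ne'⟩, by simpa using hx⟩

theorem mem_torsion_of_nsmul {A : Type*} [AddCommGroup A] {x : A} {n : ℕ} (hn : n ≠ 0)
    (hx : n • x = 0) : x ∈ AddCommGroup.torsion A :=
  (isOfFinAddOrder_iff_nsmul_eq_zero).2 ⟨n, Nat.pos_of_ne_zero hn, hx⟩

include t π in
theorem exists_card_primaryComponent_le_of_addTower (ht : ∀ n, t n ^ p ^ n = 1)
    (hπ : ∀ n, Function.Surjective (π n)) (hcomm : ∀ n x, π n (t (n + 1) x) = t n (π n x))
    (hker : ∀ n x, π n x = 0 ↔ ∃ y, x = (t (n + 1) ^ p ^ n) y - y) :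
    ∃ N, ∀ n ≥ N, Nat.card (AddCommGroup.primaryComponent (D n) p) ≤
      Nat.card (AddCommGroup.primaryComponent (D (n + 1)) p) := by
  let T : ∀ n, Module.End ℤ_[p] (ℤ_[p] ⊗[ℤ] D n) := fun n =>
    ((t n).toIntLinearMap : D n →ₗ[ℤ] D n).baseChange ℤ_[p]
  have hTtmul : ∀ n i a x, (T n ^ i) (a ⊗ₜ x) = a ⊗ₜ ((t n ^ i) x) := by
    intro n i
    induction i with
    | zero => intro a x; rfl
    | succ i ih =>
      intro a x
      rw [pow_succ, pow_succ, Module.End.mul_apply]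
      exact ih a (t n x)
  have hT : ∀ n, T n ^ p ^ n = 1 := fun n => by
    refine LinearMap.ext fun z => ?_
    induction z using TensorProduct.induction_on with
    | zero => simp
    | add x y hx hy => rw [map_add, hx, hy, map_add]
    | tmul a x => rw [hTtmul, ht]; rfl
  let inst : ∀ n, Module ℤ_[p]⟦X⟧ (ℤ_[p] ⊗[ℤ] D n) := fun n =>
    Module.compHom _ (iwasawaAction n (T n) (hT n))
  have hsmul : ∀ n (a : ℤ_[p]⟦X⟧) (z : ℤ_[p] ⊗[ℤ] D n),
    a • z = iwasawaAction n (T n) (hT n) a z := fun n a z => rfl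
  have htower : ∀ n, IsScalarTower ℤ_[p] ℤ_[p]⟦X⟧ (ℤ_[p] ⊗[ℤ] D n) := fun n =>
    IsScalarTower.of_algebraMap_smul fun a z => by
      have h : algebraMap ℤ_[p] ℤ_[p]⟦X⟧ a = ((Polynomial.C a : Polynomial ℤ_[p]) : ℤ_[p]⟦X⟧) := by
        simp
      rw [hsmul, h, iwasawaAction_coe, Polynomial.aeval_C]
      rfl
  have hfin : ∀ n, Module.Finite ℤ_[p]⟦X⟧ (ℤ_[p] ⊗[ℤ] D n) := fun n =>
    Module.Finite.of_restrictScalars_finite ℤ_[p] _ _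
  let θ' : ∀ n, (ℤ_[p] ⊗[ℤ] D (n + 1)) →ₗ[ℤ_[p]] ℤ_[p] ⊗[ℤ] D n := fun n =>
    (π n).toIntLinearMap.baseChange ℤ_[p]
  have hθT : ∀ n z, θ' n (T (n + 1) z) = T n (θ' n z) := by
    intro n z
    induction z using TensorProduct.induction_on with
    | zero => simp
    | add x y hx hy => simp only [map_add, hx, hy]
    | tmul a x =>
      change a ⊗ₜ[ℤ] (π n (t (n + 1) x)) = a ⊗ₜ[ℤ] (t n (π n x))
      rw [hcomm]
  let θ : ∀ n, (ℤ_[p] ⊗[ℤ] D (n + 1)) →ₗ[ℤ_[p]⟦X⟧] ℤ_[p] ⊗[ℤ] D n := fun n =>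
    { toFun := θ' n
      map_add' := map_add _
      map_smul' := fun a z =>
        map_iwasawaAction n.le_succ _ (hT (n + 1)) _ (hT n) (θ' n) (hθT n) a z }
  have hequiv := fun n => nonempty_primaryComponent_equiv (p := p) (D n)
  have hprim : ∀ n, Finite (AddCommGroup.primaryComponent (D n) p) := fun n =>
    Finite.of_injective (fun x => (⟨x, by
      obtain ⟨k, hk⟩ := x.2
      exact mem_torsion_of_nsmul (pow_ne_zero k (Fact.out (p := p.Prime)).ne_zero) hk⟩ :
        AddCommGroup.torsion (D n)))
      fun x y hxy => Subtype.ext (Subtype.mk.inj hxy)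
  obtain ⟨N, hN⟩ := exists_card_primaryComponent_le_of_tower θ
    (fun n => LinearMap.lTensor_surjective ℤ_[p] (hπ n))
    (fun n z => by rw [hsmul, iwasawaAction_omega, hT, sub_self]; rfl)
    -- Right exactness of the tensor product preserves the coinvariants, and `ω n` acts as `T (n +
    -- 1) ^ p ^ n - 1`.
    (fun n z hz => by
      have hex : Function.Exact (((t (n + 1) ^ p ^ n - 1 : AddMonoid.End (D (n + 1))) :
          D (n + 1) →+ D (n + 1)).toIntLinearMap) (π n).toIntLinearMap := by
        intro x
        refine (hker n x).trans ⟨fun ⟨y, hy⟩ => ⟨y, hy.symm⟩, fun ⟨y, hy⟩ => ⟨y, hy.symm⟩⟩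
      obtain ⟨w, rfl⟩ := (lTensor_exact ℤ_[p] hex (hπ n) z).1 hz
      refine ⟨w, ?_⟩
      rw [hsmul, iwasawaAction_omega]
      clear hz
      induction w using TensorProduct.induction_on with
      | zero => simp
      | add x y hx hy => simp only [map_add, hx, hy]
      | tmul a x =>
        rw [LinearMap.lTensor_tmul, LinearMap.sub_apply, hTtmul]
        exact TensorProduct.tmul_sub _ _ _)
    (fun n => Finite.of_equiv _ (hequiv n).some)
  refine ⟨N, fun n hn => ?_⟩
  rw [Nat.card_congr (hequiv n).some, Nat.card_congr (hequiv (n + 1)).some]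
  exact hN n hn

theorem finite_killedBy {A : Type*} [AddCommGroup A] [Module.Finite ℤ A] (P : ℕ → Prop)
    (hP : ∀ m, P m → m ≠ 0) : Finite (killedBy P A) :=
  Finite.of_injective (fun x => (⟨x, by
    obtain ⟨m, hm, hx⟩ := x.2
    exact mem_torsion_of_nsmul (hP m hm) hx⟩ : AddCommGroup.torsion A))
    fun x y hxy => Subtype.ext (Subtype.mk.inj hxy)

omit [Fact p.Prime] in
theorem killedBy_coprime (A : Type*) [AddCommGroup A] :
    killedBy (fun m => m.Coprime p) A = (nonPTorsion A p : Set A) := by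
  ext x
  constructor
  · rintro ⟨m, hm, hx⟩
    exact Nat.Coprime.coprime_dvd_left (addOrderOf_dvd_of_nsmul_eq_zero hx) hm
  · intro hx
    exact ⟨addOrderOf x, hx, addOrderOf_nsmul_eq_zero x⟩

theorem killedBy_primePow (A : Type*) [AddCommGroup A] (l : ℕ) :
    killedBy (fun m => ∃ k, m = l ^ k) A = (AddCommGroup.primaryComponent A l : Set A) := by
  ext x
  constructor
  · rintro ⟨_, ⟨k, rfl⟩, hx⟩
    exact ⟨k, hx⟩
  · rintro ⟨k, hx⟩
    exact ⟨_, ⟨k, rfl⟩, hx⟩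

theorem card_torsion_eq_mul (A : Type*) [AddCommGroup A] :
    Nat.card (AddCommGroup.torsion A) =
      Nat.card (nonPTorsion A p) * Nat.card (AddCommGroup.primaryComponent A p) := by
  have hp := (Fact.out (p := p.Prime))
  rw [← Nat.card_prod]
  symm
  refine Nat.card_congr (Equiv.ofBijective
    (fun x => ⟨(x.1 : A) + x.2, (AddCommGroup.torsion A).add_mem ?_ ?_⟩) ⟨?_, ?_⟩)
  · refine mem_torsion_of_nsmul (n := addOrderOf (x.1 : A)) (fun h => ?_)
      (addOrderOf_nsmul_eq_zero _)
    have h2 : (addOrderOf (x.1 : A)).Coprime p := x.1.2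
    rw [h, Nat.coprime_zero_left] at h2
    exact hp.one_lt.ne' h2
  · obtain ⟨k, hk⟩ := x.2.2
    exact mem_torsion_of_nsmul (pow_ne_zero k hp.ne_zero) hk
  · have hzero : ∀ z : A, z ∈ nonPTorsion A p → z ∈ AddCommGroup.primaryComponent A p → z = 0 := by
      rintro z hz ⟨k, hk⟩
      have hz' : (addOrderOf z).Coprime p := hz
      have h1 := addOrderOf_dvd_of_nsmul_eq_zero hk
      exact AddMonoid.addOrderOf_eq_one_iff.1
        (Nat.eq_one_of_dvd_coprimes (hz'.pow_right k) dvd_rfl h1)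
    rintro ⟨x, y⟩ ⟨x', y'⟩ h
    have h' : (x : A) + y = x' + y' := congrArg Subtype.val h
    have hz : (x : A) - x' = y' - y := by
      rw [sub_eq_sub_iff_add_eq_add, h', add_comm]
    have h0 := hzero (x - x') ((nonPTorsion A p).sub_mem x.2 x'.2)
      (by rw [hz]; exact (AddCommGroup.primaryComponent A p).sub_mem y'.2 y.2)
    rw [h0] at hz
    exact Prod.ext (Subtype.ext (sub_eq_zero.1 h0)) (Subtype.ext (sub_eq_zero.1 hz.symm).symm)
  · rintro ⟨z, hz⟩
    obtain ⟨n, hn, hnz⟩ := (isOfFinAddOrder_iff_nsmul_eq_zero).1 hz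
    -- With `a * p ^ k + b * m = 1`, the summand `a • p ^ k • z` is killed by `m` and `b • m • z` by
    -- `p ^ k`.
    obtain ⟨k, m, hm, rfl⟩ := Nat.exists_eq_pow_mul_and_not_dvd hn.ne' p hp.ne_one
    have hcop : (p ^ k).Coprime m :=
      Nat.Coprime.pow_left k ((Nat.Prime.coprime_iff_not_dvd hp).2 hm)
    obtain ⟨a, b, hab⟩ : ∃ a b : ℤ, a * (p ^ k : ℕ) + b * m = 1 :=
      Nat.isCoprime_iff_coprime.2 hcop
    have e1 : m • (a • (p ^ k) • z) = 0 := by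
      rw [smul_comm, ← mul_smul m, mul_comm, hnz, smul_zero]
    have e2 : p ^ k • (b • m • z) = 0 := by
      rw [smul_comm, ← mul_smul (p ^ k), hnz, smul_zero]
    refine ⟨⟨⟨a • (p ^ k) • z, ?_⟩, ⟨b • m • z, k, e2⟩⟩, Subtype.ext ?_⟩
    · exact Nat.Coprime.coprime_dvd_left (addOrderOf_dvd_of_nsmul_eq_zero e1)
        ((Nat.Prime.coprime_iff_not_dvd hp).2 hm).symm
    · change a • (p ^ k) • z + b • m • z = z
      conv_rhs => rw [← one_smul ℤ z, ← hab, add_smul, mul_smul, mul_smul,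
        natCast_zsmul, natCast_zsmul]

include t π in
/-- Convergence of the orders of the torsion subgroups in a tower of finitely generated groups, in
which every layer is the group of coinvariants of the next. -/
theorem tower_torsion_converges (ht : ∀ n, t n ^ p ^ n = 1)
    (hπ : ∀ n, Function.Surjective (π n)) (hcomm : ∀ n x, π n (t (n + 1) x) = t n (π n x))
    (hker : ∀ n x, π n x = 0 ↔ ∃ y, x = (t (n + 1) ^ p ^ n) y - y) :
    (∀ n, Finite (AddCommGroup.torsion (D n))) ∧
    (∃ a : ℤ_[p], Tendsto
      (fun n => (Nat.card (AddCommGroup.torsion (D n)) : ℤ_[p])) atTop (𝓝 a)) ∧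
    (∃ a : ℤ_[p], Tendsto
      (fun n => (Nat.card (nonPTorsion (D n) p) : ℤ_[p])) atTop (𝓝 a)) ∧
    (∀ l : ℕ, l.Prime → ∃ a : ℤ_[p], Tendsto
      (fun n => (Nat.card (AddCommGroup.primaryComponent (D n) l) : ℤ_[p])) atTop (𝓝 a)) := by
  have hp := (Fact.out (p := p.Prime))
  have hP : ∀ P : ℕ → Prop, (∀ m, P m → m.Coprime p) → ∃ a : ℤ_[p], Tendsto
      (fun n => (Nat.card (killedBy P (D n)) : ℤ_[p])) atTop (𝓝 a) := fun P hP =>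
    PadicInt.exists_tendsto_of_modEq _ fun n => by
      have := finite_killedBy (A := D (n + 1)) P fun m hm h0 => by
        have := hP m hm
        rw [h0, Nat.coprime_zero_left] at this
        exact hp.one_lt.ne' this
      exact card_killedBy_modEq (t (n + 1)) (π n) P (ht (n + 1)) (hπ n) (hker n) hP
  have hnonp : ∃ a : ℤ_[p], Tendsto
      (fun n => (Nat.card (nonPTorsion (D n) p) : ℤ_[p])) atTop (𝓝 a) := by
    have := hP (fun m => m.Coprime p) fun m hm => hm
    simp_rw [killedBy_coprime] at this
    exact this
  have hprim : ∃ a : ℤ_[p], Tendsto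
      (fun n => (Nat.card (AddCommGroup.primaryComponent (D n) p) : ℤ_[p])) atTop (𝓝 a) := by
    obtain ⟨N, hN⟩ := exists_card_primaryComponent_le_of_addTower t π ht hπ hcomm hker
    refine PadicInt.exists_tendsto_of_eventually_monotone _ N (fun n => ?_) hN
    have hfin : Finite (AddCommGroup.primaryComponent (D n) p) := by
      have := finite_killedBy (A := D n) (fun m => ∃ k, m = p ^ k) (by
        rintro _ ⟨k, rfl⟩; exact pow_ne_zero k hp.ne_zero)
      rw [killedBy_primePow] at this
      exact this
    have hpg : IsPGroup p (Multiplicative (AddCommGroup.primaryComponent (D n) p)) := by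
      rintro ⟨x, k, hk⟩
      exact ⟨k, Subtype.ext hk⟩
    obtain ⟨k, hk⟩ := IsPGroup.iff_card.1 hpg
    exact ⟨k, hk⟩
  refine ⟨fun n => inferInstance, ?_, hnonp, fun l hl => ?_⟩
  · obtain ⟨a, ha⟩ := hnonp
    obtain ⟨b, hb⟩ := hprim
    refine ⟨a * b, ?_⟩
    simp_rw [fun n => card_torsion_eq_mul (p := p) (D n), Nat.cast_mul]
    exact ha.mul hb
  · by_cases hlp : l = p
    · subst hlp; exact hprim
    · have := hP (fun m => ∃ k, m = l ^ k) (by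
        rintro _ ⟨k, rfl⟩
        exact Nat.Coprime.pow_left k ((Nat.coprime_primes hl hp).2 hlp))
      simp_rw [killedBy_primePow] at this
      exact this

end Tower

/-! ### Faces of the standard triangle -/

/-- The `i`-th face of the standard `2`-simplex, parametrised by the unit interval. -/
noncomputable def triangleFace (i : Fin 3) : C(unitInterval, stdSimplex ℝ (Fin 3)) :=
  (⟨stdSimplex.map (Fin.succAbove i), stdSimplex.continuous_map _⟩ :
    C(stdSimplex ℝ (Fin 2), stdSimplex ℝ (Fin 3))).comp
    (stdSimplexHomeomorphUnitInterval.symm : C(unitInterval, stdSimplex ℝ (Fin 2)))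

theorem triangleFace_apply (i : Fin 3) (t : unitInterval) (j : Fin 3) :
    triangleFace i t j =
      (if i.succAbove 0 = j then 1 - (t : ℝ) else 0) +
        if i.succAbove 1 = j then (t : ℝ) else 0 := by
  change FunOnFinite.linearMap ℝ ℝ (Fin.succAbove i) _ j = _
  rw [FunOnFinite.linearMap_apply_apply, Finset.sum_filter, Fin.sum_univ_two]
  rfl

theorem triangleFace_zero_apply (t : unitInterval) :
    (triangleFace 0 t : Fin 3 → ℝ) = ![0, 1 - (t : ℝ), (t : ℝ)] := by
  ext j
  rw [triangleFace_apply, show (0 : Fin 3).succAbove 0 = 1 by decide,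
    show (0 : Fin 3).succAbove 1 = 2 by decide]
  fin_cases j <;> simp

theorem triangleFace_one_apply (t : unitInterval) :
    (triangleFace 1 t : Fin 3 → ℝ) = ![1 - (t : ℝ), 0, (t : ℝ)] := by
  ext j
  rw [triangleFace_apply, show (1 : Fin 3).succAbove 0 = 0 by decide,
    show (1 : Fin 3).succAbove 1 = 2 by decide]
  fin_cases j <;> simp

theorem triangleFace_two_apply (t : unitInterval) :
    (triangleFace 2 t : Fin 3 → ℝ) = ![1 - (t : ℝ), (t : ℝ), 0] := by
  ext j
  rw [triangleFace_apply, show (2 : Fin 3).succAbove 0 = 0 by decide,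
    show (2 : Fin 3).succAbove 1 = 1 by decide]
  fin_cases j <;> simp

/-! ### Singular `1`-chains modulo boundaries -/

section EdgeGroup

variable (Y : Type*) [TopologicalSpace Y]

/-- The boundary of a singular triangle, as a combination of paths. -/
noncomputable def triangleBoundary {Y : Type*} [TopologicalSpace Y]
    (τ : C(stdSimplex ℝ (Fin 3), Y)) : C(unitInterval, Y) →₀ ℤ :=
  Finsupp.single (τ.comp (triangleFace 0)) 1 - Finsupp.single (τ.comp (triangleFace 1)) 1 +
    Finsupp.single (τ.comp (triangleFace 2)) 1

/-- Singular `1`-chains modulo boundaries. -/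
abbrev EdgeGroup : Type _ :=
  (C(unitInterval, Y) →₀ ℤ) ⧸ Submodule.span ℤ (Set.range (triangleBoundary (Y := Y)))

namespace EdgeGroup

variable {Y} {Z : Type*} [TopologicalSpace Z]

/-- The class of a path. -/
noncomputable def edge (γ : C(unitInterval, Y)) : EdgeGroup Y :=
  Submodule.mkQ _ (Finsupp.single γ 1)

theorem edge_triangle (τ : C(stdSimplex ℝ (Fin 3), Y)) :
    edge (τ.comp (triangleFace 0)) + edge (τ.comp (triangleFace 2)) =
      edge (τ.comp (triangleFace 1)) := by
  have : Submodule.mkQ (Submodule.span ℤ (Set.range (triangleBoundary (Y := Y))))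
      (triangleBoundary τ) = 0 :=
    (Submodule.Quotient.mk_eq_zero _).2 (Submodule.subset_span ⟨τ, rfl⟩)
  rw [triangleBoundary, map_add, map_sub] at this
  rw [← sub_eq_zero, ← this]
  simp only [edge]
  abel

theorem induction_on {P : EdgeGroup Y → Prop} (q : EdgeGroup Y) (zero : P 0)
    (edge : ∀ γ, P (edge γ)) (add : ∀ a b, P a → P b → P (a + b)) (neg : ∀ a, P a → P (-a)) :
    P q := by
  obtain ⟨f, rfl⟩ := Submodule.mkQ_surjective _ q
  induction f using Finsupp.induction_linear with
  | zero => simpa using zero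
  | add f g hf hg => rw [map_add]; exact add _ _ hf hg
  | single γ n =>
    have : Finsupp.single γ n = n • Finsupp.single γ (1 : ℤ) := by simp
    rw [this, map_zsmul]
    induction n using Int.induction_on with
    | zero => simpa using zero
    | succ n ih => rw [add_smul, one_smul]; exact add _ _ (ih (by simp)) (edge γ)
    | pred n ih =>
      rw [sub_smul, one_smul, sub_eq_add_neg]; exact add _ _ (ih (by simp)) (neg _ (edge γ))

theorem hom_ext {A : Type*} [AddCommGroup A] {f g : EdgeGroup Y →+ A}
    (h : ∀ γ, f (edge γ) = g (edge γ)) : f = g := by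
  ext1 q
  induction q using induction_on with
  | zero => simp
  | edge γ => exact h γ
  | add a b ha hb => rw [map_add, map_add, ha, hb]
  | neg a ha => rw [map_neg, map_neg, ha]

/-- A function on paths which is additive on triangles extends to the edge group. -/
noncomputable def lift {A : Type*} [AddCommGroup A] (f : C(unitInterval, Y) → A)
    (hf : ∀ τ : C(stdSimplex ℝ (Fin 3), Y),
      f (τ.comp (triangleFace 0)) + f (τ.comp (triangleFace 2)) = f (τ.comp (triangleFace 1))) :
    EdgeGroup Y →+ A :=
  (Submodule.liftQ _ (Finsupp.linearCombination ℤ f) (by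
    rw [Submodule.span_le]
    rintro _ ⟨τ, rfl⟩
    rw [SetLike.mem_coe, LinearMap.mem_ker, triangleBoundary, map_add, map_sub]
    simp only [Finsupp.linearCombination_single, one_smul]
    rw [← hf]
    abel)).toAddMonoidHom

@[simp]
theorem lift_edge {A : Type*} [AddCommGroup A] (f : C(unitInterval, Y) → A) (hf)
    (γ : C(unitInterval, Y)) : lift f hf (edge γ) = f γ := by
  change Finsupp.linearCombination ℤ f (Finsupp.single γ 1) = f γ
  simp

/-- The map induced by a continuous map. -/
noncomputable def map (f : C(Y, Z)) : EdgeGroup Y →+ EdgeGroup Z :=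
  lift (fun γ => edge (f.comp γ)) fun τ => edge_triangle (f.comp τ)

@[simp]
theorem map_edge (f : C(Y, Z)) (γ : C(unitInterval, Y)) : map f (edge γ) = edge (f.comp γ) :=
  lift_edge _ _ _

theorem map_map {W : Type*} [TopologicalSpace W] (g : C(Z, W)) (f : C(Y, Z)) (q : EdgeGroup Y) :
    map g (map f q) = map (g.comp f) q :=
  DFunLike.congr_fun (hom_ext (f := (map g).comp (map f)) (g := map (g.comp f))
    fun γ => by simp [ContinuousMap.comp_assoc]) q

theorem map_id (q : EdgeGroup Y) : map (ContinuousMap.id Y) q = q :=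
  DFunLike.congr_fun (hom_ext (f := map (ContinuousMap.id Y)) (g := AddMonoidHom.id _)
    fun γ => by simp) q

theorem triangleFace_zero_zero : triangleFace 0 0 = triangleFace 2 1 := by
  ext j; rw [triangleFace_zero_apply, triangleFace_two_apply]; fin_cases j <;> simp

theorem triangleFace_one_zero : triangleFace 1 0 = triangleFace 2 0 := by
  ext j; rw [triangleFace_one_apply, triangleFace_two_apply]; fin_cases j <;> simp

theorem triangleFace_one_one : triangleFace 1 1 = triangleFace 0 1 := by
  ext j; rw [triangleFace_one_apply, triangleFace_zero_apply]; fin_cases j <;> simp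

variable (Y) in
/-- The boundary map from the edge group to `0`-chains. -/
noncomputable def boundary : EdgeGroup Y →+ (Y →₀ ℤ) :=
  lift (fun γ => Finsupp.single (γ 1) 1 - Finsupp.single (γ 0) 1) fun τ => by
    simp only [ContinuousMap.comp_apply, triangleFace_zero_zero, triangleFace_one_zero,
      triangleFace_one_one]
    abel

@[simp]
theorem boundary_edge (γ : C(unitInterval, Y)) :
    boundary Y (edge γ) = Finsupp.single (γ 1) 1 - Finsupp.single (γ 0) 1 :=
  lift_edge _ _ _

/-- The `0`-chains are free, so a torsion class is a class of cycles. -/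
theorem boundary_eq_zero_of_nsmul {q : EdgeGroup Y} {n : ℕ} (hn : n ≠ 0) (hq : n • q = 0) :
    boundary Y q = 0 := by
  have h : n • boundary Y q = 0 := by rw [← map_nsmul, hq, map_zero]
  ext y
  have := DFunLike.congr_fun h y
  simpa [hn] using this

end EdgeGroup

end EdgeGroup

/-! ### Comparison with singular homology -/

section Comparison

open CategoryTheory Limits Simplicial EdgeGroup

/-- The coefficient module of `H1`. -/
noncomputable abbrev coeffZ : ModuleCat.{u} ℤ := ModuleCat.of ℤ (ULift.{u} ℤ)

/-- The singular chain complex computing `H1`. -/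
noncomputable abbrev singComplex (Y : TopCat.{u}) : ChainComplex (ModuleCat.{u} ℤ) ℕ :=
  (TopCat.toSSet.obj Y).chainComplex coeffZ.{u}

/-- The chain module is a direct sum of copies of `ℤ`. Degree `0` is what forces torsion modulo
boundaries to come from `H_1`. -/
theorem nsmul_eq_zero_singComplex (Y : TopCat.{u}) (k : ℕ) (x : (singComplex Y).X k) {n : ℕ}
    (hn : n ≠ 0) (hx : n • x = 0) : x = 0 := by
  classical
  let e := ((TopCat.toSSet.obj Y).isColimitChainComplexXCofan coeffZ.{u} k).coconePointUniqueUpToIso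
    (ModuleCat.coproductCoconeIsColimit (R := ℤ)
      fun _ : (TopCat.toSSet.obj Y) _⦋k⦌ => coeffZ.{u})
  let f : (singComplex Y).X k ≃ₗ[ℤ]
    DirectSum ((TopCat.toSSet.obj Y) _⦋k⦌) (fun _ => ULift.{u} ℤ) := e.toLinearEquiv
  have h1 : n • f x = 0 := by rw [← map_nsmul, hx, map_zero]
  have h2 : f x = 0 := by
    refine DFinsupp.ext fun i => ?_
    have h3 := DFunLike.congr_fun h1 i
    have h4 : n • ((f x) i : ULift.{u} ℤ) = 0 := h3
    have h5 := congrArg ULift.down h4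
    apply ULift.down_injective
    simpa [hn] using h5
  exact (map_eq_zero_iff f f.injective).1 h2

variable (Y : TopCat.{u})

/-- A path as a singular `1`-simplex. -/
noncomputable def pathSimplex : (TopCat.toSSet.obj Y) _⦋1⦌ ≃ C(unitInterval, Y) :=
  (TopCat.toSSetObjEquiv Y (.op ⦋1⦌)).trans
    (stdSimplexHomeomorphUnitInterval.continuousMapCongr (.refl _))

theorem pathSimplex_δ (τ : (TopCat.toSSet.obj Y) _⦋2⦌) (i : Fin 3) :
    pathSimplex Y ((TopCat.toSSet.obj Y).δ i τ) =
      (TopCat.toSSetObjEquiv Y (.op ⦋2⦌) τ).comp (triangleFace i) := rfl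

theorem pOpcycles_triangle (τ : (TopCat.toSSet.obj Y) _⦋2⦌) (r : coeffZ.{u}) :
    ((TopCat.toSSet.obj Y).ιChainComplex ((TopCat.toSSet.obj Y).δ 0 τ) ≫
      (singComplex Y).pOpcycles 1).hom r +
    ((TopCat.toSSet.obj Y).ιChainComplex ((TopCat.toSSet.obj Y).δ 2 τ) ≫
      (singComplex Y).pOpcycles 1).hom r =
    ((TopCat.toSSet.obj Y).ιChainComplex ((TopCat.toSSet.obj Y).δ 1 τ) ≫
      (singComplex Y).pOpcycles 1).hom r := by
  have h : (TopCat.toSSet.obj Y).ιChainComplex τ ≫ (singComplex Y).d 2 1 ≫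
      (singComplex Y).pOpcycles 1 = 0 := by
    rw [HomologicalComplex.d_pOpcycles, comp_zero]
  rw [← Category.assoc, SSet.ιChainComplex_d, Preadditive.sum_comp, Fin.sum_univ_three] at h
  have h' := congrArg (fun f => f.hom r) h
  simp only [Fin.isValue, Fin.coe_ofNat_eq_mod, Nat.zero_mod, pow_zero, one_smul, Nat.one_mod,
    pow_one, neg_smul, Preadditive.neg_comp, Nat.mod_succ, even_two,
    Even.neg_pow, one_pow, ModuleCat.hom_add, ModuleCat.hom_neg, LinearMap.add_apply,
    LinearMap.neg_apply, ModuleCat.hom_zero, LinearMap.zero_apply] at h'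
  rw [← sub_eq_zero, ← h']
  abel

/-- Edges modulo boundaries, in the singular chain complex and concretely. -/
noncomputable def edgeGroupToOpcycles : EdgeGroup Y →+ (singComplex Y).opcycles 1 :=
  lift (fun γ => ((TopCat.toSSet.obj Y).ιChainComplex ((pathSimplex Y).symm γ) ≫
      (singComplex Y).pOpcycles 1).hom (ULift.up 1)) fun τ => by
    obtain ⟨τ, rfl⟩ := (TopCat.toSSetObjEquiv Y (.op ⦋2⦌)).surjective τ
    simp_rw [← pathSimplex_δ, Equiv.symm_apply_apply]
    exact pOpcycles_triangle Y τ _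

/-- The linear map from the coefficients determined by the image of `1`. -/
noncomputable def coeffHom (A : ModuleCat.{u} ℤ) (a : A) : coeffZ.{u} ⟶ A :=
  ModuleCat.ofHom ((LinearMap.toSpanSingleton ℤ A a).comp ULift.moduleEquiv.toLinearMap)

/-- Singular `1`-chains mapped to the edge group. -/
noncomputable def chainsToEdgeGroup : (singComplex Y).X 1 ⟶ ModuleCat.of ℤ (EdgeGroup Y) :=
  Sigma.desc fun σ : (TopCat.toSSet.obj Y) _⦋1⦌ =>
    coeffHom (ModuleCat.of ℤ (EdgeGroup Y)) (edge (pathSimplex Y σ))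

theorem ι_chainsToEdgeGroup (σ : (TopCat.toSSet.obj Y) _⦋1⦌) :
    (TopCat.toSSet.obj Y).ιChainComplex σ ≫ chainsToEdgeGroup Y =
      coeffHom (ModuleCat.of ℤ (EdgeGroup Y)) (edge (pathSimplex Y σ)) :=
  Sigma.ι_desc _ _

/-- Trades the scalar action bundled in `A` for the integer multiples of its additive group, in
which the edge group is handled. -/
theorem coeffHom_apply (A : ModuleCat.{u} ℤ) (a : A) (r : coeffZ.{u}) :
    (coeffHom A a).hom r = r.down • a :=
  int_smul_eq_zsmul A.isModule r.down a

theorem coeffHom_add (A : ModuleCat.{u} ℤ) (a b : A) :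
    coeffHom A a + coeffHom A b = coeffHom A (a + b) := by
  ext r
  change (coeffHom A a).hom r + (coeffHom A b).hom r = (coeffHom A (a + b)).hom r
  rw [coeffHom_apply, coeffHom_apply, coeffHom_apply]
  exact (zsmul_add a b r.down).symm

theorem d_chainsToEdgeGroup : (singComplex Y).d 2 1 ≫ chainsToEdgeGroup Y = 0 := by
  refine SSet.chainComplex_hom_ext fun τ => ?_
  rw [← Category.assoc, SSet.ιChainComplex_d, Preadditive.sum_comp, Fin.sum_univ_three, comp_zero]
  simp only [Fin.isValue, Fin.coe_ofNat_eq_mod, Nat.zero_mod, pow_zero, one_smul, Nat.one_mod,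
    pow_one, neg_smul, Preadditive.neg_comp, Nat.mod_succ, even_two, Even.neg_pow, one_pow,
    ι_chainsToEdgeGroup, pathSimplex_δ]
  rw [← (coeffHom_add (ModuleCat.of ℤ (EdgeGroup Y)) _ _).trans
    (congrArg _ (edge_triangle (TopCat.toSSetObjEquiv Y (.op ⦋2⦌) τ)))]
  abel

/-- Singular `1`-chains modulo boundaries mapped to the edge group. -/
noncomputable def opcyclesToEdgeGroup :
    (singComplex Y).opcycles 1 ⟶ ModuleCat.of ℤ (EdgeGroup Y) :=
  (singComplex Y).descOpcycles (chainsToEdgeGroup Y) 2 (by simp) (d_chainsToEdgeGroup Y)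

theorem edgeGroupToOpcycles_leftInverse (x : (singComplex Y).opcycles 1) :
    edgeGroupToOpcycles Y ((opcyclesToEdgeGroup Y).hom x) = x := by
  let g : ModuleCat.of ℤ (EdgeGroup Y) ⟶ (singComplex Y).opcycles 1 :=
    ModuleCat.ofHom
      { edgeGroupToOpcycles Y with
        map_smul' := fun n x => (map_zsmul (edgeGroupToOpcycles Y) n x).trans
          (int_smul_eq_zsmul ((singComplex Y).opcycles 1).isModule n _).symm }
  have : opcyclesToEdgeGroup Y ≫ g = 𝟙 _ := by
    rw [← cancel_epi ((singComplex Y).pOpcycles 1), Category.comp_id, opcyclesToEdgeGroup,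
      HomologicalComplex.p_descOpcycles_assoc]
    refine SSet.chainComplex_hom_ext fun σ => ?_
    rw [← Category.assoc, ι_chainsToEdgeGroup]
    ext r
    change edgeGroupToOpcycles Y ((coeffHom (ModuleCat.of ℤ (EdgeGroup Y)) _).hom r) = _
    rw [coeffHom_apply, map_zsmul, edgeGroupToOpcycles, lift_edge,
      Equiv.symm_apply_apply, ← map_zsmul]
    congr 1
    exact ULift.ext _ _ (by simp)
  exact congrArg (fun f => f.hom x) this

theorem edgeGroupToOpcycles_rightInverse (q : EdgeGroup Y) :
    (opcyclesToEdgeGroup Y).hom (edgeGroupToOpcycles Y q) = q := by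
  refine DFunLike.congr_fun (hom_ext (f := (opcyclesToEdgeGroup Y).hom.toAddMonoidHom.comp
    (edgeGroupToOpcycles Y)) (g := AddMonoidHom.id _) fun γ => ?_) q
  change (opcyclesToEdgeGroup Y).hom (edgeGroupToOpcycles Y (edge γ)) = edge γ
  rw [edgeGroupToOpcycles, lift_edge]
  have : ((TopCat.toSSet.obj Y).ιChainComplex ((pathSimplex Y).symm γ) ≫
      (singComplex Y).pOpcycles 1) ≫ opcyclesToEdgeGroup Y =
      coeffHom (ModuleCat.of ℤ (EdgeGroup Y)) (edge γ) := by
    rw [Category.assoc, opcyclesToEdgeGroup, HomologicalComplex.p_descOpcycles,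
      ι_chainsToEdgeGroup, Equiv.apply_symm_apply]
  refine (congrArg (fun f => f.hom (ULift.up 1)) this).trans ?_
  rw [coeffHom_apply, one_smul]

/-- First homology embeds into the edge group, and the image contains all torsion. -/
theorem exists_H1_to_edgeGroup : ∃ j : H1 Y →+ EdgeGroup Y, Function.Injective j ∧
    ∀ q : EdgeGroup Y, ∀ n : ℕ, n ≠ 0 → n • q = 0 → q ∈ Set.range j := by
  let K := singComplex Y
  let ι : K.homology 1 ⟶ K.opcycles 1 := K.homologyι 1
  have hι : Function.Injective ι.hom := (ModuleCat.mono_iff_injective ι).1 inferInstance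
  let j : H1 Y →+ EdgeGroup Y :=
    (opcyclesToEdgeGroup Y).hom.toAddMonoidHom.comp ι.hom.toAddMonoidHom
  refine ⟨j, fun a b hab => hι ?_, fun q n hn hq => ?_⟩
  · have h := congrArg (edgeGroupToOpcycles Y) hab
    have e : ∀ a, edgeGroupToOpcycles Y (j a) = ι.hom a := fun a =>
      edgeGroupToOpcycles_leftInverse Y _
    rwa [e, e] at h
  · set x := edgeGroupToOpcycles Y q with hx
    have hnx : n • x = 0 := by rw [hx, ← map_nsmul, hq, map_zero]
    have h0 : (K.fromOpcycles 1 0).hom x = 0 := by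
      refine nsmul_eq_zero_singComplex Y 0 _ hn ?_
      rw [← map_nsmul, hnx, map_zero]
    -- `H_1` is the kernel of the boundary from `1`-chains modulo boundaries to `0`-chains.
    have hex : (ShortComplex.mk _ _ (K.homologyι_comp_fromOpcycles 1 0)).Exact :=
      ShortComplex.exact_of_f_is_kernel _ (K.homologyIsKernel 1 0 (by simp))
    obtain ⟨y, hy⟩ := (ShortComplex.moduleCat_exact_iff _).1 hex x h0
    refine ⟨y, ?_⟩
    have hy' : ι.hom y = x := hy
    change (opcyclesToEdgeGroup Y).hom (ι.hom y) = q
    rw [hy', hx, edgeGroupToOpcycles_rightInverse]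

end Comparison

/-! ### Local potentials and finite generation -/

section EdgeGeometry

open unitInterval

namespace EdgeGroup

variable {Y : Type*} [TopologicalSpace Y]

theorem edge_add_of_triangle (τ : C(stdSimplex ℝ (Fin 3), Y)) {α β γ : C(I, Y)}
    (hα : ∀ t, τ (triangleFace 2 t) = α t) (hβ : ∀ t, τ (triangleFace 0 t) = β t)
    (hγ : ∀ t, τ (triangleFace 1 t) = γ t) : edge α + edge β = edge γ := by
  have h := edge_triangle τ
  rw [show τ.comp (triangleFace 2) = α from ContinuousMap.ext hα,
    show τ.comp (triangleFace 0) = β from ContinuousMap.ext hβ,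
    show τ.comp (triangleFace 1) = γ from ContinuousMap.ext hγ] at h
  rw [add_comm, h]

theorem edge_const (y : Y) : edge (ContinuousMap.const I y) = 0 := by
  have := edge_add_of_triangle (ContinuousMap.const _ y) (α := ContinuousMap.const I y)
    (β := ContinuousMap.const I y) (γ := ContinuousMap.const I y) (fun _ => rfl) (fun _ => rfl)
    (fun _ => rfl)
  simpa using this

/-- Clamping a real number to the unit interval. -/
noncomputable def clamp : C(ℝ, I) := ⟨Set.projIcc 0 1 zero_le_one, continuous_projIcc⟩

theorem clamp_coe (t : I) : clamp (t : ℝ) = t :=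
  Set.projIcc_val zero_le_one t

theorem clamp_zero : clamp 0 = 0 := clamp_coe 0

theorem clamp_one : clamp 1 = 1 := clamp_coe 1

/-- A coordinate function on the standard `2`-simplex. -/
noncomputable def simplexCoord (i : Fin 3) : C(stdSimplex ℝ (Fin 3), ℝ) :=
  ⟨fun x => x.1 i, (continuous_apply i).comp continuous_subtype_val⟩

theorem simplexCoord_face_zero (t : I) (i : Fin 3) :
    simplexCoord i (triangleFace 0 t) = ![0, 1 - (t : ℝ), (t : ℝ)] i :=
  congrFun (triangleFace_zero_apply t) i

theorem simplexCoord_face_one (t : I) (i : Fin 3) :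
    simplexCoord i (triangleFace 1 t) = ![1 - (t : ℝ), 0, (t : ℝ)] i :=
  congrFun (triangleFace_one_apply t) i

theorem simplexCoord_face_two (t : I) (i : Fin 3) :
    simplexCoord i (triangleFace 2 t) = ![1 - (t : ℝ), (t : ℝ), 0] i :=
  congrFun (triangleFace_two_apply t) i

/-- The diagonal cuts the square into two triangles, and both sums equal its class. In the simplex
coordinates the triangles are `(x₁ + x₂, x₂)` and `(x₂, x₁ + x₂)`; clamping only serves to land in
the interval. -/
theorem edge_square (H : C(I × I, Y)) {α β γ δ : C(I, Y)} (hα : ∀ t, H (t, 0) = α t)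
    (hβ : ∀ t, H (1, t) = β t) (hγ : ∀ t, H (0, t) = γ t) (hδ : ∀ t, H (t, 1) = δ t) :
    edge α + edge β = edge γ + edge δ := by
  let diag : C(I, Y) := H.comp ((ContinuousMap.id I).prodMk (ContinuousMap.id I))
  have h1 : edge α + edge β = edge diag := by
    refine edge_add_of_triangle (H.comp ((clamp.comp (simplexCoord 1 + simplexCoord 2)).prodMk
      (clamp.comp (simplexCoord 2)))) (fun t => ?_) (fun t => ?_) (fun t => ?_)
    · simp [simplexCoord_face_two, clamp_coe, clamp_zero, hα]
    · simp [simplexCoord_face_zero, clamp_coe, clamp_one, hβ]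
    · simp [simplexCoord_face_one, clamp_coe, diag]
  have h2 : edge γ + edge δ = edge diag := by
    refine edge_add_of_triangle (H.comp ((clamp.comp (simplexCoord 2)).prodMk
      (clamp.comp (simplexCoord 1 + simplexCoord 2)))) (fun t => ?_) (fun t => ?_) (fun t => ?_)
    · simp [simplexCoord_face_two, clamp_coe, clamp_zero, hγ]
    · simp [simplexCoord_face_zero, clamp_coe, clamp_one, hδ]
    · simp [simplexCoord_face_one, clamp_coe, diag]
  rw [h1, h2]

/-- The restriction of a path to a subinterval, reparametrised. -/
noncomputable def segment (γ : C(I, Y)) (a b : I) : C(I, Y) :=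
  γ.comp (clamp.comp ⟨fun t : I => (1 - (t : ℝ)) * a + t * b, by fun_prop⟩)

theorem segment_zero_one (γ : C(I, Y)) : segment γ 0 1 = γ := by
  ext t; simp [segment, clamp_coe]

/-- The affine triangle in the interval with vertices `a`, `b`, `c`, degenerate as it is, bounds the
three segments. No order of the points is needed. -/
theorem edge_segment_add (γ : C(I, Y)) (a b c : I) :
    edge (segment γ a b) + edge (segment γ b c) = edge (segment γ a c) := by
  refine edge_add_of_triangle (γ.comp (clamp.comp ((a : ℝ) • simplexCoord 0 +
    (b : ℝ) • simplexCoord 1 + (c : ℝ) • simplexCoord 2))) (fun t => ?_) (fun t => ?_) (fun t => ?_)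
  · simp [simplexCoord_face_two, segment, mul_comm]
  · simp [simplexCoord_face_zero, segment, mul_comm]
  · simp [simplexCoord_face_one, segment, mul_comm]

theorem edge_segment_self (γ : C(I, Y)) (a : I) : edge (segment γ a a) = 0 := by
  simpa using edge_segment_add γ a a a

theorem edge_segment_eq_sum (γ : C(I, Y)) (t : ℕ → I) (n : ℕ) :
    edge (segment γ (t 0) (t n)) = ∑ k ∈ Finset.range n, edge (segment γ (t k) (t (k + 1))) := by
  induction n with
  | zero => simp [edge_segment_self]
  | succ n ih => rw [Finset.sum_range_succ, ← ih, edge_segment_add]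

theorem segment_mem (γ : C(I, Y)) {a b : I} (hab : a ≤ b) (s : I) :
    ∃ r ∈ Set.Icc a b, segment γ a b s = γ r := by
  have hab' : (a : ℝ) ≤ b := hab
  have h1 : (a : ℝ) ≤ (1 - (s : ℝ)) * a + s * b := by nlinarith [s.2.1]
  have h2 : (1 - (s : ℝ)) * a + s * b ≤ b := by nlinarith [s.2.2]
  let r : I := ⟨(1 - (s : ℝ)) * a + s * b, a.2.1.trans h1, h2.trans b.2.2⟩
  exact ⟨r, ⟨h1, h2⟩, congrArg γ (clamp_coe r)⟩

/-- A potential on `U` computes the class of every path in `U` from its end points. -/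
def IsPotentialOn (g : Y → EdgeGroup Y) (U : Set Y) : Prop :=
  ∀ γ : C(I, Y), (∀ t, γ t ∈ U) → edge γ = g (γ 1) - g (γ 0)

/-- Near a point of `U ∩ V`, a short path inside `U ∩ V` has its class computed by both potentials,
so their difference is locally constant; a compact set then gives finitely many values. -/
theorem finite_image_sub_of_isPotentialOn [LocallyPathConnectedSpace Y] {U V : Set Y}
    (hU : IsOpen U) (hV : IsOpen V) {g h : Y → EdgeGroup Y} (hg : IsPotentialOn g U)
    (hh : IsPotentialOn h V) {C : Set Y} (hC : IsCompact C) (hCU : C ⊆ U) (hCV : C ⊆ V) :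
    ((fun x => g x - h x) '' C).Finite := by
  have : CompactSpace C := isCompact_iff_compactSpace.1 hC
  have hlc : IsLocallyConstant fun x : C => g x - h x := by
    rw [IsLocallyConstant.iff_eventually_eq]
    rintro ⟨x, hx⟩
    obtain ⟨W, ⟨hWx, hWpc⟩, hWsub⟩ := (path_connected_basis x).mem_iff.1
      ((hU.inter hV).mem_nhds ⟨hCU hx, hCV hx⟩)
    have hev : ∀ᶠ y in 𝓝 x, g y - h y = g x - h x := by
      filter_upwards [hWx] with y hy
      obtain ⟨γ, hγ⟩ := hWpc.joinedIn x (mem_of_mem_nhds hWx) y hy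
      have e1 := hg γ.toContinuousMap fun t => (hWsub (hγ t)).1
      have e2 := hh γ.toContinuousMap fun t => (hWsub (hγ t)).2
      rw [e1] at e2
      have e3 : g y - g x = h y - h x := by simpa using e2
      rw [sub_eq_sub_iff_add_eq_add] at e3 ⊢
      rw [e3, add_comm]
    exact ((continuous_subtype_val (p := (· ∈ C))).tendsto ⟨x, hx⟩).eventually hev
  have := hlc.range_finite
  refine this.subset ?_
  rintro _ ⟨x, hx, rfl⟩
  exact ⟨⟨x, hx⟩, rfl⟩

/-- In a compact space with local potentials, the edge group is finitely generated up to the choice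
of a value for every point. -/
theorem exists_finite_generation [CompactSpace Y] [T2Space Y] [LocallyPathConnectedSpace Y]
    (hloc : ∀ y : Y, ∃ U, IsOpen U ∧ y ∈ U ∧ ∃ g : Y → EdgeGroup Y, IsPotentialOn g U) :
    ∃ (g : Y → EdgeGroup Y) (S : Set (EdgeGroup Y)), S.Finite ∧
      ∀ q, q - Finsupp.linearCombination ℤ g (boundary Y q) ∈ AddSubgroup.closure S := by
  choose U hUo hyU g hg using hloc
  choose K hK hyK hKU using fun y => exists_compact_subset (hUo y) (hyU y)
  obtain ⟨F, hF⟩ := CompactSpace.elim_nhds_subcover (fun y => interior (K y))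
    (fun y => isOpen_interior.mem_nhds (hyK y))
  have hcover : ∀ x, ∃ y ∈ F, x ∈ interior (K y) := fun x => by
    have : x ∈ ⋃ y ∈ F, interior (K y) := by rw [hF]; trivial
    simpa using this
  choose i hiF hi using hcover
  -- `S` collects the transition values between the potentials of a finite cover. Passing to the
  -- compact sets `K y` is what makes them finite in number.
  let S : Set (EdgeGroup Y) := ⋃ y ∈ F, ⋃ z ∈ F, (fun x => g y x - g z x) '' (K y ∩ K z)
  have hSfin : S.Finite := F.finite_toSet.biUnion fun y _ => F.finite_toSet.biUnion fun z _ =>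
    finite_image_sub_of_isPotentialOn (hUo y) (hUo z) (hg y) (hg z)
      ((hK y).inter_right (hK z).isClosed) (Set.inter_subset_left.trans (hKU y))
      (Set.inter_subset_right.trans (hKU z))
  let g' : Y → EdgeGroup Y := fun x => g (i x) x
  refine ⟨g', S, hSfin, fun q => ?_⟩
  -- On a path inside one `K y`, the end-point correction leaves just a difference of two transition
  -- values; a general path is subdivided into such pieces.
  let r : EdgeGroup Y →+ EdgeGroup Y := AddMonoidHom.id _ -
    (Finsupp.linearCombination ℤ g').toAddMonoidHom.comp (boundary Y)
  have hr : ∀ q, r q = q - Finsupp.linearCombination ℤ g' (boundary Y q) := fun q => rfl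
  have hredge : ∀ γ, r (edge γ) = edge γ - (g' (γ 1) - g' (γ 0)) := fun γ => by
    rw [hr, boundary_edge, map_sub]; simp
  have hsmall : ∀ y ∈ F, ∀ γ : C(I, Y), (∀ t, γ t ∈ K y) →
      r (edge γ) ∈ AddSubgroup.closure S := by
    intro y hy γ hγ
    have hmem : ∀ x ∈ K y, g y x - g' x ∈ AddSubgroup.closure S := fun x hx =>
      AddSubgroup.subset_closure (Set.mem_biUnion hy (Set.mem_biUnion (hiF x)
        ⟨x, ⟨hx, interior_subset (hi x)⟩, rfl⟩))
    rw [hredge, hg y γ fun t => hKU y (hγ t)]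
    have : g y (γ 1) - g y (γ 0) - (g' (γ 1) - g' (γ 0)) =
      (g y (γ 1) - g' (γ 1)) - (g y (γ 0) - g' (γ 0)) := by abel
    rw [this]
    exact sub_mem (hmem _ (hγ 1)) (hmem _ (hγ 0))
  rw [← hr]
  induction q using induction_on with
  | zero => rw [map_zero]; exact zero_mem _
  | add a b ha hb => rw [map_add]; exact add_mem ha hb
  | neg a ha => rw [map_neg]; exact neg_mem ha
  | edge γ =>
    obtain ⟨t, ht0, htm, ⟨n, hn⟩, htc⟩ := exists_monotone_Icc_subset_open_cover_unitInterval
      (c := fun y : F => γ ⁻¹' interior (K y)) (fun y => isOpen_interior.preimage γ.continuous)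
      (fun s _ => Set.mem_iUnion.2 ⟨⟨i (γ s), hiF _⟩, hi _⟩)
    have : edge γ = ∑ k ∈ Finset.range n, edge (segment γ (t k) (t (k + 1))) := by
      rw [← edge_segment_eq_sum, ht0, hn n le_rfl, segment_zero_one]
    rw [this, map_sum]
    refine sum_mem fun k _ => ?_
    obtain ⟨y, hy⟩ := htc k
    refine hsmall y y.2 _ fun s => ?_
    obtain ⟨w, hw, hws⟩ := segment_mem γ (htm k.le_succ) s
    rw [hws]
    exact interior_subset (hy hw)

/-- A ball in the half-space is convex, so a path in it can be coned to the centre. The square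
relation for this cone expresses its class by the segments from its end points, and the potential is
minus the class of the segment to the centre. -/
theorem exists_isPotentialOn_chart (e : OpenPartialHomeomorph Y (EuclideanHalfSpace 3)) (y : Y)
    (hy : y ∈ e.source) :
    ∃ U, IsOpen U ∧ y ∈ U ∧ ∃ g : Y → EdgeGroup Y, IsPotentialOn g U := by
  classical
  have hnhds : e.target ∈ comap Subtype.val (𝓝 (e y).1) := by
    rw [← nhds_induced]
    exact e.open_target.mem_nhds (e.map_source hy)
  obtain ⟨ε, hε, hball⟩ := (Metric.nhds_basis_ball.comap _).mem_iff.1 hnhds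
  let U := e.source ∩ e ⁻¹' (Subtype.val ⁻¹' Metric.ball (e y).1 ε)
  let comb : I → EuclideanHalfSpace 3 → EuclideanHalfSpace 3 := fun s w =>
    ⟨(1 - (s : ℝ)) • w.1 + (s : ℝ) • (e y).1, by
      have h1 := w.2
      have h2 := (e y).2
      have h3 := s.2.1
      have h4 := s.2.2
      simp only [PiLp.add_apply, PiLp.smul_apply, smul_eq_mul]
      nlinarith [mul_nonneg (sub_nonneg.2 h4) h1, mul_nonneg h3 h2]⟩
  have hcomb : Continuous fun z : I × EuclideanHalfSpace 3 => comb z.1 z.2 :=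
    Continuous.subtype_mk (by fun_prop) _
  have hmem : ∀ s, ∀ w ∈ U, comb s (e w) ∈ e.target := by
    intro s w hw
    apply hball
    have h1 : dist (e w).1 (e y).1 < ε := hw.2
    rw [Set.mem_preimage, Metric.mem_ball, dist_eq_norm]
    rw [dist_eq_norm] at h1
    have : (comb s (e w)).1 - (e y).1 = (1 - (s : ℝ)) • ((e w).1 - (e y).1) := by
      change (1 - (s : ℝ)) • (e w).1 + (s : ℝ) • (e y).1 - (e y).1 = _
      module
    rw [this, norm_smul, Real.norm_of_nonneg (sub_nonneg.2 s.2.2)]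
    nlinarith [s.2.1, norm_nonneg ((e w).1 - (e y).1)]
  let IsLine : Y → C(I, Y) → Prop := fun w c => ∀ s, c s = e.symm (comb s (e w))
  -- The default `0` applies only where the segment is not a continuous path, which does not happen
  -- on `U`.
  let g : Y → EdgeGroup Y := fun w => if h : ∃ c, IsLine w c then -edge h.choose else 0
  have hg : ∀ w c, IsLine w c → g w = -edge c := by
    intro w c hc
    have h : ∃ c, IsLine w c := ⟨c, hc⟩
    have : h.choose = c := ContinuousMap.ext fun s => by rw [h.choose_spec s, hc s]
    rw [show g w = -edge h.choose from dif_pos h, this]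
  refine ⟨U, e.isOpen_inter_preimage (Metric.isOpen_ball.preimage continuous_subtype_val),
    ⟨hy, Metric.mem_ball_self hε⟩, g, fun γ hγ => ?_⟩
  have heγ : Continuous fun t => e (γ t) :=
    e.continuousOn.comp_continuous γ.continuous fun t => (hγ t).1
  let H : C(I × I, Y) := ⟨fun z => e.symm (comb z.2 (e (γ z.1))),
    e.continuousOn_symm.comp_continuous
      (hcomb.comp (continuous_snd.prodMk (heγ.comp continuous_fst)))
      fun z => hmem _ _ (hγ _)⟩
  have hsq := edge_square H (α := γ) (β := H.comp ((ContinuousMap.const I 1).prodMk (.id I)))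
    (γ := H.comp ((ContinuousMap.const I 0).prodMk (.id I))) (δ := ContinuousMap.const I y)
    (fun t => by
      have : comb 0 (e (γ t)) = e (γ t) := Subtype.ext (by simp [comb])
      change e.symm (comb 0 (e (γ t))) = _
      rw [this, e.left_inv (hγ t).1])
    (fun _ => rfl) (fun _ => rfl)
    (fun t => by
      have : comb 1 (e (γ t)) = e y := Subtype.ext (by simp [comb])
      change e.symm (comb 1 (e (γ t))) = _
      rw [this, e.left_inv hy]; rfl)
  rw [edge_const, add_zero] at hsq
  rw [hg (γ 1) (H.comp ((ContinuousMap.const I 1).prodMk (.id I))) fun s => rfl,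
    hg (γ 0) (H.comp ((ContinuousMap.const I 0).prodMk (.id I))) fun s => rfl, ← hsq]
  abel

end EdgeGroup

end EdgeGeometry

/-! ### Edge groups of covering spaces -/

section EdgeCovering

open unitInterval

instance : LocallyPathConnectedSpace (stdSimplex ℝ (Fin 3)) :=
  (convex_stdSimplex ℝ (Fin 3)).locallyPathConnectedSpace

instance : ContractibleSpace (stdSimplex ℝ (Fin 3)) :=
  (convex_stdSimplex ℝ (Fin 3)).contractibleSpace ⟨_, single_mem_stdSimplex ℝ 0⟩

instance : LocallyPathConnectedSpace I := (convex_Icc (0 : ℝ) 1).locallyPathConnectedSpace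

instance : ContractibleSpace I :=
  (convex_Icc (0 : ℝ) 1).contractibleSpace ⟨0, by simp⟩

namespace EdgeGroup

variable {E B X : Type*} [TopologicalSpace E] [TopologicalSpace B] [TopologicalSpace X]
  {π : C(E, X)} {ρ : C(B, X)} {f : C(E, B)}

/-- Lifting along a map between covering spaces of the same space. -/
theorem exists_lift_of_covering (hπ : IsCoveringMap π) (hρ : IsCoveringMap ρ)
    (hf : ρ.comp f = π) {A : Type*} [TopologicalSpace A] [SimplyConnectedSpace A]
    [LocallyPathConnectedSpace A] (θ : C(A, B)) (a : A) (w : E) (hw : f w = θ a) :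
    ∃ F : C(A, E), F a = w ∧ f.comp F = θ := by
  obtain ⟨F, ⟨hF1, hF2⟩, -⟩ := hπ.existsUnique_continuousMap_lifts (ρ.comp θ) a w
    (by rw [← hf]; exact congrArg ρ hw)
  refine ⟨F, hF1, ContinuousMap.ext fun x => ?_⟩
  refine congrFun (hρ.eq_of_comp_eq (f.comp F).continuous θ.continuous ?_ a ?_) x
  · rw [← hf] at hF2
    exact hF2
  · rw [ContinuousMap.comp_apply, hF1, hw]

/-- If points in the same fibre of `f` are related by transformations congruent to `1` modulo
`s - 1`, the edge group of the base is the group of coinvariants. -/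
theorem map_eq_zero_iff_of_covering (hπ : IsCoveringMap π) (hρ : IsCoveringMap ρ)
    (hf : ρ.comp f = π) (hsurj : Function.Surjective f) (s : C(E, E)) (hs : f.comp s = f)
    (horb : ∀ w w', f w = f w' → ∃ d : C(E, E), d w = w' ∧ f.comp d = f ∧
      ∀ q, map d q - q ∈ (map s - AddMonoidHom.id (EdgeGroup E)).range) (x : EdgeGroup E) :
    map f x = 0 ↔ ∃ y, x = map s y - y := by
  constructor
  · let R := (map s - AddMonoidHom.id (EdgeGroup E)).range
    have hex : ∀ γ : C(I, B), ∃ Γ : C(I, E), f.comp Γ = γ := fun γ => by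
      obtain ⟨w, hw⟩ := hsurj (γ 0)
      obtain ⟨Γ, -, hΓ⟩ := exists_lift_of_covering hπ hρ hf γ 0 w hw
      exact ⟨Γ, hΓ⟩
    -- Two lifts of a path differ by the transformation relating their starting points, hence agree
    -- modulo `R`. So lifting paths gives an inverse `φ` modulo `R`; triangles lift too, which makes
    -- it additive.
    have huniq : ∀ Γ Γ' : C(I, E), f.comp Γ = f.comp Γ' →
        (QuotientAddGroup.mk (edge Γ) : EdgeGroup E ⧸ R) = QuotientAddGroup.mk (edge Γ') := by
      intro Γ Γ' h
      obtain ⟨d, hd, hfd, hmem⟩ := horb (Γ 0) (Γ' 0) (DFunLike.congr_fun h 0)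
      have hlift : d.comp Γ = Γ' := by
        refine ContinuousMap.ext fun t => congrFun (hπ.eq_of_comp_eq
          (d.comp Γ).continuous Γ'.continuous ?_ 0 hd) t
        have : π.comp (d.comp Γ) = π.comp Γ' := by
          rw [← hf, ContinuousMap.comp_assoc, ContinuousMap.comp_assoc, ← h,
            ← ContinuousMap.comp_assoc f, hfd]
        exact congrArg DFunLike.coe this
      rw [← hlift, ← map_edge, eq_comm, QuotientAddGroup.eq_iff_sub_mem]
      exact hmem _
    choose Λ hΛ using hex
    let φ : EdgeGroup B →+ EdgeGroup E ⧸ R := lift (fun γ => QuotientAddGroup.mk (edge (Λ γ)))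
      fun τ => by
        obtain ⟨w, hw⟩ := hsurj (τ (stdSimplex.vertex 0))
        obtain ⟨T, -, hT⟩ := exists_lift_of_covering hπ hρ hf τ _ w hw
        have h : ∀ i, (QuotientAddGroup.mk (edge (Λ (τ.comp (triangleFace i)))) :
            EdgeGroup E ⧸ R) = QuotientAddGroup.mk (edge (T.comp (triangleFace i))) := fun i =>
          huniq _ _ (by rw [hΛ, ← ContinuousMap.comp_assoc, hT])
        rw [h, h, h, ← QuotientAddGroup.mk_add, edge_triangle]
    have hφ : φ.comp (map f) = QuotientAddGroup.mk' R := hom_ext fun γ => by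
      rw [AddMonoidHom.comp_apply, map_edge, lift_edge]
      exact huniq _ _ (hΛ _)
    intro hx
    have h0 : (QuotientAddGroup.mk x : EdgeGroup E ⧸ R) = 0 := by
      have := DFunLike.congr_fun hφ x
      rw [AddMonoidHom.comp_apply, hx, map_zero] at this
      exact this.symm
    obtain ⟨y, hy⟩ := (QuotientAddGroup.eq_zero_iff x).1 h0
    exact ⟨y, hy.symm⟩
  · rintro ⟨y, rfl⟩
    rw [map_sub, map_map, hs, sub_self]

theorem map_surjective_of_covering (hπ : IsCoveringMap π) (hρ : IsCoveringMap ρ)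
    (hf : ρ.comp f = π) (hsurj : Function.Surjective f) : Function.Surjective (map f) := by
  intro q
  induction q using induction_on with
  | zero => exact ⟨0, map_zero _⟩
  | edge γ =>
    obtain ⟨w, hw⟩ := hsurj (γ 0)
    obtain ⟨Γ, -, hΓ⟩ := exists_lift_of_covering hπ hρ hf γ 0 w hw
    exact ⟨edge Γ, by rw [map_edge, hΓ]⟩
  | add a b ha hb =>
    obtain ⟨a, rfl⟩ := ha
    obtain ⟨b, rfl⟩ := hb
    exact ⟨a + b, map_add _ _ _⟩
  | neg a ha =>
    obtain ⟨a, rfl⟩ := ha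
    exact ⟨-a, map_neg _ _⟩

/-! ### Retraction to boundaries over the base point -/

section Retraction

/-- A choice of paths from all points to a base point, constant at the base point. -/
structure PathSystem (X : Type*) [TopologicalSpace X] where
  /-- the base point -/
  base : X
  /-- the chosen path to the base point -/
  path : X → C(I, X)
  path_zero : ∀ x, path x 0 = x
  path_one : ∀ x, path x 1 = base
  path_base : path base = ContinuousMap.const I base

theorem exists_pathSystem (X : Type*) [TopologicalSpace X] [PathConnectedSpace X] (x₀ : X) :
    ∃ c : PathSystem X, c.base = x₀ := by
  classical
  let γ : ∀ x : X, Path x x₀ := fun x => (PathConnectedSpace.joined x x₀).some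
  refine ⟨⟨x₀, fun x => if x = x₀ then ContinuousMap.const I x₀ else (γ x).toContinuousMap,
    fun x => ?_, fun x => ?_, by simp⟩, rfl⟩
  · by_cases h : x = x₀
    · simp [h]
    · simp [h]
  · by_cases h : x = x₀
    · simp [h]
    · simp [h]

variable (c : PathSystem X) (hπ : IsCoveringMap π) (hρ : IsCoveringMap ρ)

/-- The lifted path, from a point of the covering space to the fibre over the base point. -/
noncomputable def liftedPath (y : E) : C(I, E) := hπ.liftPath (c.path (π y)) y (c.path_zero _)

theorem liftedPath_zero (y : E) : liftedPath c hπ y 0 = y := hπ.liftPath_zero _ _ _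

theorem proj_liftedPath_one (y : E) : π (liftedPath c hπ y 1) = c.base := by
  have := congrFun (hπ.liftPath_lifts (c.path (π y)) y (c.path_zero _)) 1
  exact this.trans (c.path_one _)

theorem liftedPath_of_proj_eq (y : E) (hy : π y = c.base) :
    liftedPath c hπ y = ContinuousMap.const I y := by
  symm
  refine (hπ.eq_liftPath_iff' _).2 ⟨?_, rfl⟩
  ext t
  rw [hy, c.path_base]
  exact hy

theorem comp_liftedPath (hf : ρ.comp f = π) (y : E) :
    f.comp (liftedPath c hπ y) = liftedPath c hρ (f y) := by
  refine (hρ.eq_liftPath_iff' _).2 ⟨?_, ?_⟩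
  · have h := hπ.liftPath_lifts (c.path (π y)) y (c.path_zero _)
    have h2 : ρ (f y) = π y := DFunLike.congr_fun hf y
    rw [h2, ← h]
    funext t
    exact DFunLike.congr_fun hf _
  · rw [ContinuousMap.comp_apply, liftedPath_zero]

/-- The projection of the edge group to classes with boundary in the fibre over the base point. -/
noncomputable def retraction : EdgeGroup E →+ EdgeGroup E :=
  AddMonoidHom.id _ + (Finsupp.linearCombination ℤ fun y =>
    edge (liftedPath c hπ y)).toAddMonoidHom.comp (boundary E)

theorem retraction_apply (q : EdgeGroup E) : retraction c hπ q =
    q + Finsupp.linearCombination ℤ (fun y => edge (liftedPath c hπ y)) (boundary E q) := rfl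

theorem retraction_edge (γ : C(I, E)) : retraction c hπ (edge γ) =
    edge γ + (edge (liftedPath c hπ (γ 1)) - edge (liftedPath c hπ (γ 0))) := by
  rw [retraction_apply, boundary_edge, map_sub]
  simp

theorem boundary_retraction_edge (γ : C(I, E)) : boundary E (retraction c hπ (edge γ)) =
    Finsupp.single (liftedPath c hπ (γ 1) 1) 1 - Finsupp.single (liftedPath c hπ (γ 0) 1) 1 := by
  rw [retraction_edge, map_add, map_sub]
  simp only [boundary_edge, liftedPath_zero]
  abel

/-- After one application the boundary lies over the base point, where the lifted paths are constant
and have class zero. This is why a path system is required to be constant at its base point. -/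
theorem retraction_retraction (q : EdgeGroup E) :
    retraction c hπ (retraction c hπ q) = retraction c hπ q := by
  refine DFunLike.congr_fun (hom_ext (f := (retraction c hπ).comp (retraction c hπ))
    (g := retraction c hπ) fun γ => ?_) q
  rw [AddMonoidHom.comp_apply, retraction_apply _ _ (retraction c hπ (edge γ)),
    boundary_retraction_edge, map_sub]
  simp [liftedPath_of_proj_eq c hπ _ (proj_liftedPath_one c hπ _), edge_const]

theorem retraction_of_boundary_eq_zero {q : EdgeGroup E} (hq : boundary E q = 0) :
    retraction c hπ q = q := by
  rw [retraction_apply, hq, map_zero, add_zero]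

/-- The lifted paths on both sides lie over the same paths in `X`, so `f` matches them by uniqueness
of lifts. The case `ρ = π` covers deck transformations. -/
theorem map_retraction (hf : ρ.comp f = π) (q : EdgeGroup E) :
    map f (retraction c hπ q) = retraction c hρ (map f q) := by
  refine DFunLike.congr_fun (hom_ext (f := (map f).comp (retraction c hπ))
    (g := (retraction c hρ).comp (map f)) fun γ => ?_) q
  rw [AddMonoidHom.comp_apply, AddMonoidHom.comp_apply, retraction_edge, map_edge, retraction_edge,
    map_add, map_sub, map_edge, map_edge, map_edge, comp_liftedPath c hπ hρ hf,
    comp_liftedPath c hπ hρ hf]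
  rfl

/-- Classes in the range have boundary supported on the finite fibre, so finitely many values of
`g`, together with `S`, generate a group containing them. -/
theorem finite_range_retraction (hfib : (π ⁻¹' {c.base}).Finite) (g : E → EdgeGroup E)
    (S : Set (EdgeGroup E)) (hS : S.Finite)
    (hgS : ∀ q, q - Finsupp.linearCombination ℤ g (boundary E q) ∈ AddSubgroup.closure S) :
    Module.Finite ℤ (retraction c hπ).range := by
  let T := AddSubgroup.closure (S ∪ g '' (π ⁻¹' {c.base}))
  have hle : (retraction c hπ).range ≤ T := by
    rintro _ ⟨q, rfl⟩
    have h1 := AddSubgroup.closure_mono (Set.subset_union_left (t := g '' (π ⁻¹' {c.base})))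
      (hgS (retraction c hπ q))
    have hmem : ∀ y, g (liftedPath c hπ y 1) ∈ T := fun y => AddSubgroup.subset_closure
      (Or.inr ⟨_, proj_liftedPath_one c hπ y, rfl⟩)
    have h2 : Finsupp.linearCombination ℤ g (boundary E (retraction c hπ q)) ∈ T := by
      clear h1
      induction q using induction_on with
      | zero => simp
      | edge γ =>
        rw [boundary_retraction_edge, map_sub]
        simpa using sub_mem (hmem (γ 1)) (hmem (γ 0))
      | add a b ha hb => simp only [map_add]; exact add_mem ha hb
      | neg a ha => simp only [map_neg]; exact neg_mem ha
    have := add_mem h1 h2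
    rwa [sub_add_cancel] at this
  have hN : IsNoetherian ℤ (Submodule.span ℤ (S ∪ g '' (π ⁻¹' {c.base}))) :=
    isNoetherian_span_of_finite ℤ (hS.union (hfib.image g))
  have hN' : IsNoetherian ℤ (AddSubgroup.toIntSubmodule (retraction c hπ).range) := by
    refine isNoetherian_of_le (t := Submodule.span ℤ (S ∪ g '' (π ⁻¹' {c.base}))) ?_
    intro x hx
    have := hle hx
    rw [← Submodule.mem_toAddSubgroup, Submodule.span_int_eq_addSubgroupClosure]
    exact this
  exact inferInstanceAs (Module.Finite ℤ (AddSubgroup.toIntSubmodule (retraction c hπ).range))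

end Retraction

end EdgeGroup

end EdgeCovering

/-! ### Quotient coverings and equivariance -/

section QuotientCovering

variable {E B X G H : Type*} [TopologicalSpace E] [TopologicalSpace B] [TopologicalSpace X]
  [AddCommGroup G] [AddAction G E] [AddCommGroup H] [AddAction H B]
  {π : C(E, X)} {ρ : C(B, X)} {f : C(E, B)}

/-- The transformation of a quotient covering space given by an element of the group. -/
def deckMap (hπ : IsAddQuotientCoveringMap π G) (a : G) : C(E, E) :=
  ⟨(a +ᵥ ·), hπ.continuous_const_vadd a⟩

theorem deckMap_apply (hπ : IsAddQuotientCoveringMap π G) (a : G) (w : E) :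
    deckMap hπ a w = a +ᵥ w := rfl

theorem comp_deckMap (hπ : IsAddQuotientCoveringMap π G) (a : G) :
    π.comp (deckMap hπ a) = π :=
  ContinuousMap.ext fun _ => hπ.map_vadd a

/-- The endomorphism of the edge group given by an element of the covering group. -/
noncomputable def deckEnd (hπ : IsAddQuotientCoveringMap π G) (a : G) :
    AddMonoid.End (EdgeGroup E) :=
  EdgeGroup.map (deckMap hπ a)

theorem deckEnd_pow (hπ : IsAddQuotientCoveringMap π G) (a : G) (k : ℕ) :
    deckEnd hπ a ^ k = deckEnd hπ (k • a) := by
  induction k with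
  | zero =>
    have : deckMap hπ (0 • a) = ContinuousMap.id E :=
      ContinuousMap.ext fun w => by rw [zero_nsmul, deckMap_apply, zero_vadd]; rfl
    rw [pow_zero, deckEnd, this]
    exact AddMonoidHom.ext fun q => (EdgeGroup.map_id q).symm
  | succ k ih =>
    have : deckMap hπ ((k + 1) • a) = (deckMap hπ (k • a)).comp (deckMap hπ a) :=
      ContinuousMap.ext fun w => by
        rw [add_nsmul, one_nsmul, deckMap_apply, add_vadd]; rfl
    rw [pow_succ, ih, deckEnd, deckEnd, deckEnd, this]
    exact AddMonoidHom.ext fun q => EdgeGroup.map_map _ _ q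

theorem finite_fiber_of_quotientCovering [Finite G] (hπ : IsAddQuotientCoveringMap π G) (x : X) :
    (π ⁻¹' {x}).Finite := by
  obtain ⟨w, rfl⟩ := hπ.surjective x
  refine (Set.finite_range fun a : G => a +ᵥ w).subset fun w' hw' => ?_
  obtain ⟨a, ha⟩ := hπ.apply_eq_iff_mem_orbit.1 hw'
  exact ⟨a, ha⟩

/-- A finite quotient covering space of a compact space is compact. -/
theorem compactSpace_of_quotientCovering [Finite G] [CompactSpace X]
    (hπ : IsAddQuotientCoveringMap π G) : CompactSpace E := by
  have hclosed : IsClosedMap π := by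
    intro F hF
    rw [← hπ.isClosed_preimage]
    -- The saturation of a closed set is a finite union of translates.
    have : π ⁻¹' (π '' F) = ⋃ a : G, (a +ᵥ ·) ⁻¹' F := by
      ext w
      simp only [Set.mem_preimage, Set.mem_image, Set.mem_iUnion]
      constructor
      · rintro ⟨w', hw', h⟩
        obtain ⟨a, rfl⟩ := hπ.apply_eq_iff_mem_orbit.1 h
        exact ⟨a, hw'⟩
      · rintro ⟨a, ha⟩
        exact ⟨_, ha, hπ.map_vadd a⟩
    rw [this]
    exact isClosed_iUnion_of_finite fun a => hF.preimage (hπ.continuous_const_vadd a)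
  have hproper : IsProperMap π := isProperMap_iff_isClosedMap_and_compact_fibers.2
    ⟨π.continuous, hclosed, fun x => (finite_fiber_of_quotientCovering hπ x).isCompact⟩
  exact ⟨by simpa using hproper.isCompact_preimage isCompact_univ⟩

theorem t2Space_of_quotientCovering [T2Space X] (hπ : IsAddQuotientCoveringMap π G) :
    T2Space E := by
  refine ⟨fun w w' hne => ?_⟩
  by_cases h : π w = π w'
  · exact hπ.isCoveringMap.isSeparatedMap w w' h hne
  · obtain ⟨U, V, hU, hV, hwU, hwV, hd⟩ := t2_separation h
    exact ⟨π ⁻¹' U, π ⁻¹' V, hU.preimage π.continuous, hV.preimage π.continuous, hwU, hwV,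
      hd.preimage π⟩

/-- A map of connected quotient covering spaces is equivariant along a homomorphism of the
groups. -/
theorem exists_equivariant [ConnectedSpace E] (hπ : IsAddQuotientCoveringMap π G)
    (hρ : IsAddQuotientCoveringMap ρ H) (hf : ρ.comp f = π) :
    ∃ ψ : G →+ H, ∀ a w, f (a +ᵥ w) = ψ a +ᵥ f w := by
  have hfw : ∀ w, ρ (f w) = π w := fun w => DFunLike.congr_fun hf w
  let w₀ : E := Classical.arbitrary E
  have hex : ∀ a : G, ∃ h : H, ∀ w, f (a +ᵥ w) = h +ᵥ f w := by
    -- One point determines `h`; uniqueness of lifts on the connected space `E` spreads the relation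
    -- to all points.
    intro a
    obtain ⟨h, hh⟩ := hρ.apply_eq_iff_mem_orbit.1
      (show ρ (f (a +ᵥ w₀)) = ρ (f w₀) by rw [hfw, hfw, hπ.map_vadd])
    refine ⟨h, fun w => ?_⟩
    refine congrFun (hρ.isCoveringMap.eq_of_comp_eq (f.comp (deckMap hπ a)).continuous
      ((deckMap hρ h).comp f).continuous ?_ w₀ hh.symm) w
    funext w
    change ρ (f (a +ᵥ w)) = ρ (h +ᵥ f w)
    rw [hfw, hρ.map_vadd, hfw, hπ.map_vadd]
  choose ψ hψ using hex
  have hcancel := hρ.isCancelVAdd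
  refine ⟨AddMonoidHom.mk' ψ fun a b => ?_, hψ⟩
  refine IsCancelVAdd.right_cancel _ _ (f w₀) ?_
  rw [← hψ, add_vadd, hψ, hψ, add_vadd]

/-- A map between connected quotient covering spaces is onto. -/
theorem surjective_of_quotientCovering [ConnectedSpace E] [ConnectedSpace B]
    (hπ : IsAddQuotientCoveringMap π G) (hρ : IsAddQuotientCoveringMap ρ H)
    (hf : ρ.comp f = π) : Function.Surjective f := by
  have hfw : ∀ w, ρ (f w) = π w := fun w => DFunLike.congr_fun hf w
  obtain ⟨ψ, hψ⟩ := exists_equivariant hπ hρ hf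
  have hopen : IsOpen (Set.range f) := by
    have hloc : IsLocalHomeomorph f :=
      IsLocalHomeomorph.of_comp (g := ρ) (by
        have : ρ ∘ f = π := funext hfw
        rw [this]; exact hπ.isCoveringMap.isLocalHomeomorph)
        hρ.isCoveringMap.isLocalHomeomorph f.continuous
    exact hloc.isOpenMap.isOpen_range
  have hclosed : IsClosed (Set.range f) := by
    rw [← isOpen_compl_iff, isOpen_iff_mem_nhds]
    intro b hb
    obtain ⟨w, hw⟩ := hπ.surjective (ρ b)
    -- Some translate `h +ᵥ b` is in the image. If a point `f w₂` near `b` were too, comparing it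
    -- with its translate by `h` would show `h = ψ a` for some `a`, and then `b` itself would be in
    -- the image.
    obtain ⟨h, hh⟩ := hρ.apply_eq_iff_mem_orbit.1 (show ρ (f w) = ρ b by rw [hfw, hw])
    refine mem_of_superset ((hopen.preimage (hρ.continuous_const_vadd h)).mem_nhds ⟨w, hh.symm⟩) ?_
    rintro _ ⟨w₁, hw₁⟩ ⟨w₂, rfl⟩
    have hw₁' : f w₁ = h +ᵥ f w₂ := hw₁
    obtain ⟨a, rfl⟩ := hπ.apply_eq_iff_mem_orbit.1
      (show π w₁ = π w₂ by rw [← hfw, ← hfw, hw₁', hρ.map_vadd])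
    have hcancel := hρ.isCancelVAdd
    have ha : ψ a = h := IsCancelVAdd.right_cancel _ _ (f w₂) (by rw [← hψ]; exact hw₁')
    refine hb ⟨-a +ᵥ w, ?_⟩
    rw [hψ, map_neg, ha, ← hh]
    exact neg_vadd_vadd h b
  rw [← Set.range_eq_univ]
  exact IsClopen.eq_univ ⟨hclosed, hopen⟩ (Set.range_nonempty f)

theorem equivariant_surjective (hπ : IsAddQuotientCoveringMap π G)
    (hρ : IsAddQuotientCoveringMap ρ H) (hf : ρ.comp f = π) [Nonempty E]
    (hsurj : Function.Surjective f) (ψ : G →+ H) (hψ : ∀ a w, f (a +ᵥ w) = ψ a +ᵥ f w) :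
    Function.Surjective ψ := by
  intro h
  let w₀ : E := Classical.arbitrary E
  obtain ⟨w, hw⟩ := hsurj (h +ᵥ f w₀)
  obtain ⟨a, rfl⟩ := hπ.apply_eq_iff_mem_orbit.1 (show π w = π w₀ by
    rw [← hf, ContinuousMap.comp_apply, ContinuousMap.comp_apply, hw, hρ.map_vadd])
  have hcancel := hρ.isCancelVAdd
  exact ⟨a, IsCancelVAdd.right_cancel _ _ (f w₀) (by rw [← hψ]; exact hw)⟩

/-- The kernel of the map of edge groups induced by a map of quotient covering spaces, when the
kernel on the covering groups consists of the multiples of `b`. -/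
theorem EdgeGroup.map_eq_zero_iff_of_equivariant (hπ : IsAddQuotientCoveringMap π G)
    (hρ : IsAddQuotientCoveringMap ρ H) (hf : ρ.comp f = π)
    (hsurj : Function.Surjective f) (ψ : G →+ H) (hψ : ∀ a w, f (a +ᵥ w) = ψ a +ᵥ f w) (b : G)
    (hb : ∀ a, ψ a = 0 ↔ ∃ k : ℕ, a = k • b) (x : EdgeGroup E) :
    EdgeGroup.map f x = 0 ↔ ∃ y, x = deckEnd hπ b y - y := by
  have hcomp : ∀ a, ψ a = 0 → f.comp (deckMap hπ a) = f := fun a ha =>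
    ContinuousMap.ext fun w => by
      rw [ContinuousMap.comp_apply, deckMap_apply, hψ, ha, zero_vadd]
  refine EdgeGroup.map_eq_zero_iff_of_covering hπ.isCoveringMap hρ.isCoveringMap hf hsurj _
    (hcomp b ((hb b).2 ⟨1, (one_nsmul b).symm⟩)) (fun w w' hww' => ?_) x
  obtain ⟨a, rfl⟩ := hπ.apply_eq_iff_mem_orbit.1 (show π w' = π w by
    rw [← hf, ContinuousMap.comp_apply, ContinuousMap.comp_apply, hww'])
  have hcancel := hρ.isCancelVAdd
  have ha : ψ a = 0 := IsCancelVAdd.right_cancel _ _ (f w) (by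
    rw [← hψ, zero_vadd]; exact hww'.symm)
  refine ⟨deckMap hπ a, rfl, hcomp a ha, fun q => ?_⟩
  obtain ⟨k, rfl⟩ := (hb a).1 ha
  change deckEnd hπ (k • b) q - q ∈ _
  rw [← deckEnd_pow]
  clear hww' ha
  induction k with
  | zero => simp
  | succ k ih =>
    -- Telescoping: `d ^ k - 1` has its image in that of `d - 1`.
    have := add_mem ih (AddMonoidHom.mem_range.2 ⟨(deckEnd hπ b ^ k) q, rfl⟩)
    rw [AddMonoidHom.sub_apply, AddMonoidHom.id_apply, sub_add_eq_add_sub, add_sub_cancel] at this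
    rw [pow_succ']
    exact this

end QuotientCovering

/-! ### Compatible generators of the cyclic groups -/

section CyclicTower

variable {p : ℕ} [Fact p.Prime]

theorem zmod_hom_apply {m n : ℕ} [NeZero m] (h : n ∣ m) (ψ : ZMod m →+ ZMod n) (x : ZMod m) :
    ψ x = ZMod.castHom h (ZMod n) x * ψ 1 := by
  obtain ⟨k, rfl⟩ := ZMod.natCast_zmod_surjective x
  rw [map_natCast (ZMod.castHom h (ZMod n)), ← nsmul_one, map_nsmul, nsmul_eq_mul]

theorem isUnit_zmod_hom_one {m n : ℕ} [NeZero m] (h : n ∣ m) (ψ : ZMod m →+ ZMod n)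
    (hψ : Function.Surjective ψ) : IsUnit (ψ 1) := by
  obtain ⟨x, hx⟩ := hψ 1
  rw [zmod_hom_apply h] at hx
  exact IsUnit.of_mul_eq_one_right _ hx

/-- The homomorphisms need not send `1` to `1`, only to a unit `c`; dividing by `c` and lifting
units along reduction builds the generators inductively. -/
theorem exists_compatible_units (ψ : ∀ n, ZMod (p ^ (n + 1)) →+ ZMod (p ^ n))
    (hψ : ∀ n, Function.Surjective (ψ n)) :
    ∃ u : ∀ n, (ZMod (p ^ n))ˣ, ∀ n, ψ n (u (n + 1)) = u n := by
  have hnext : ∀ n (u : (ZMod (p ^ n))ˣ), ∃ v : (ZMod (p ^ (n + 1)))ˣ, ψ n v = u := by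
    intro n u
    have hdvd : p ^ n ∣ p ^ (n + 1) := pow_dvd_pow p n.le_succ
    obtain ⟨c, hc⟩ := isUnit_zmod_hom_one hdvd (ψ n) (hψ n)
    obtain ⟨v, hv⟩ := ZMod.unitsMap_surjective hdvd (u * c⁻¹)
    refine ⟨v, ?_⟩
    have hv' : ZMod.castHom hdvd (ZMod (p ^ n)) (v : ZMod (p ^ (n + 1))) =
        u * (c⁻¹ : (ZMod _)ˣ) := by
      rw [← Units.val_mul, ← hv]; rfl
    rw [zmod_hom_apply hdvd, hv', ← hc, Units.inv_mul_cancel_right]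
  choose next hnext using hnext
  exact ⟨fun n => Nat.rec 1 next n, fun n => hnext n _⟩

/-- Up to a unit, `ψ` is reduction modulo `p ^ n`. Its kernel is generated by `p ^ n`, hence also by
`p ^ n` times any unit. -/
theorem zmod_hom_eq_zero_iff {n : ℕ} (ψ : ZMod (p ^ (n + 1)) →+ ZMod (p ^ n))
    (hψ : Function.Surjective ψ) (u : (ZMod (p ^ (n + 1)))ˣ) (a : ZMod (p ^ (n + 1))) :
    ψ a = 0 ↔ ∃ k : ℕ, a = k • (p ^ n • (u : ZMod (p ^ (n + 1)))) := by
  have hdvd : p ^ n ∣ p ^ (n + 1) := pow_dvd_pow p n.le_succ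
  rw [zmod_hom_apply hdvd, (isUnit_zmod_hom_one hdvd ψ hψ).mul_left_eq_zero]
  constructor
  · intro h
    obtain ⟨m, rfl⟩ := ZMod.natCast_zmod_surjective a
    rw [map_natCast, ZMod.natCast_eq_zero_iff] at h
    obtain ⟨j, rfl⟩ := h
    obtain ⟨k, hk⟩ := ZMod.natCast_zmod_surjective
      ((j : ZMod (p ^ (n + 1))) * ((u⁻¹ : (ZMod _)ˣ) : ZMod (p ^ (n + 1))))
    refine ⟨k, ?_⟩
    rw [nsmul_eq_mul, nsmul_eq_mul, hk, mul_left_comm, Units.inv_mul_cancel_right, Nat.cast_mul]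
  · rintro ⟨k, rfl⟩
    rw [map_nsmul, map_nsmul, nsmul_eq_mul (p ^ n), ZMod.natCast_self, zero_mul, smul_zero]

end CyclicTower

/-! ### Transfer of torsion along embeddings -/

section Transfer

variable {A Q : Type*} [AddCommGroup A] [AddCommGroup Q]

theorem killedBy_ne_zero : killedBy (· ≠ 0) A = (AddCommGroup.torsion A : Set A) := by
  ext x
  constructor
  · rintro ⟨m, hm, hx⟩
    exact mem_torsion_of_nsmul hm hx
  · intro hx
    obtain ⟨m, hm, h⟩ := isOfFinAddOrder_iff_nsmul_eq_zero.1 hx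
    exact ⟨m, hm.ne', h⟩

/-- An injective homomorphism whose range contains the torsion identifies the torsion. -/
theorem nonempty_equiv_killedBy (j : A →+ Q) (hj : Function.Injective j)
    (htor : ∀ q n, n ≠ 0 → n • q = 0 → q ∈ Set.range j) (P : ℕ → Prop)
    (hP : ∀ m, P m → m ≠ 0) : Nonempty (killedBy P A ≃ killedBy P Q) := by
  refine ⟨Equiv.ofBijective (fun x => ⟨j x, mapsTo_killedBy P j x.2⟩) ⟨fun x y h => ?_, ?_⟩⟩
  · exact Subtype.ext (hj (Subtype.mk.inj h))
  · rintro ⟨q, m, hm, hq⟩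
    obtain ⟨x, rfl⟩ := htor q m (hP m hm) hq
    refine ⟨⟨x, m, hm, hj ?_⟩, rfl⟩
    rw [map_nsmul, hq, map_zero]

end Transfer

/-! ### The layers of a `ℤ_p`-cover -/

namespace ZpCover

variable {p : ℕ} {X : Type u} [TopologicalSpace X] (C : ZpCover p X)

instance (n : ℕ) : AddAction (ZMod (p ^ n)) (C.space n) := C.action n

instance (n : ℕ) : ConnectedSpace (C.space n) := C.connected n

theorem isCoveringMap (n : ℕ) : IsCoveringMap (C.proj n) := (C.isCover n).isCoveringMap

/-- There are generators of the covering groups that are compatible under the transition maps. -/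
theorem exists_generators [Fact p.Prime] : ∃ u : ∀ n, ZMod (p ^ n),
    (∀ n w, C.trans n (u (n + 1) +ᵥ w) = u n +ᵥ C.trans n w) ∧
    ∀ n x, EdgeGroup.map (C.trans n) x = 0 ↔
      ∃ y, x = (deckEnd (C.isCover (n + 1)) (u (n + 1)) ^ p ^ n) y - y := by
  choose ψ hψ using fun n =>
    exists_equivariant (C.isCover (n + 1)) (C.isCover n) (C.proj_trans n)
  have hsurj := fun n =>
    surjective_of_quotientCovering (C.isCover (n + 1)) (C.isCover n) (C.proj_trans n)
  have hψs := fun n => equivariant_surjective (C.isCover (n + 1)) (C.isCover n) (C.proj_trans n)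
    (hsurj n) (ψ n) (hψ n)
  obtain ⟨u, hu⟩ := exists_compatible_units ψ hψs
  refine ⟨fun n => u n, fun n w => by rw [hψ, hu], fun n x => ?_⟩
  rw [deckEnd_pow]
  exact EdgeGroup.map_eq_zero_iff_of_equivariant (C.isCover (n + 1)) (C.isCover n)
    (C.proj_trans n) (hsurj n) (ψ n) (hψ n) _ (zmod_hom_eq_zero_iff (ψ n) (hψs n) (u (n + 1))) x

variable [ChartedSpace (EuclideanHalfSpace 3) X]

theorem exists_chart (n : ℕ) (y : C.space n) :
    ∃ e : OpenPartialHomeomorph (C.space n) (EuclideanHalfSpace 3), y ∈ e.source := by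
  obtain ⟨e, hy, -⟩ := (C.isCoveringMap n).isLocalHomeomorph y
  refine ⟨e.trans (chartAt (EuclideanHalfSpace 3) (e y)), ?_⟩
  rw [OpenPartialHomeomorph.trans_source]
  exact ⟨hy, mem_chart_source _ _⟩

theorem locallyPathConnectedSpace (n : ℕ) : LocallyPathConnectedSpace (C.space n) := by
  choose e he using C.exists_chart n
  let : ChartedSpace (EuclideanHalfSpace 3) (C.space n) :=
    { atlas := Set.range e
      chartAt := e
      mem_chart_source := he
      chart_mem_atlas := fun y => ⟨y, rfl⟩ }
  exact ChartedSpace.locallyPathConnectedSpace (EuclideanHalfSpace 3) (C.space n)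

include C in
theorem exists_pathSystem : Nonempty (EdgeGroup.PathSystem X) := by
  have : ConnectedSpace X := (C.isCover 0).surjective.connectedSpace (C.proj 0).continuous
  have : LocallyPathConnectedSpace X :=
    ChartedSpace.locallyPathConnectedSpace (EuclideanHalfSpace 3) X
  have : PathConnectedSpace X := pathConnectedSpace_iff_connectedSpace.2 inferInstance
  obtain ⟨c, -⟩ := EdgeGroup.exists_pathSystem X (Classical.arbitrary X)
  exact ⟨c⟩

theorem finite_range_retraction [Fact p.Prime] [T2Space X] [CompactSpace X]
    (c : EdgeGroup.PathSystem X) (n : ℕ) :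
    Module.Finite ℤ (EdgeGroup.retraction c (C.isCoveringMap n)).range := by
  have := t2Space_of_quotientCovering (C.isCover n)
  have := compactSpace_of_quotientCovering (C.isCover n)
  have := C.locallyPathConnectedSpace n
  obtain ⟨g, S, hS, hgS⟩ := EdgeGroup.exists_finite_generation (Y := C.space n) fun y => by
    obtain ⟨e, he⟩ := C.exists_chart n y
    exact EdgeGroup.exists_isPotentialOn_chart e y he
  exact EdgeGroup.finite_range_retraction c _
    (finite_fiber_of_quotientCovering (C.isCover n) c.base) g S hS hgS

end ZpCover

/-! ### Assembly of the theorem -/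

theorem theorem3p1 (p : ℕ) [Fact p.Prime]
    (X : Type u) [TopologicalSpace X] [T2Space X] [CompactSpace X]
    [ChartedSpace (EuclideanHalfSpace 3) X] (C : ZpCover p X) :
    (∀ n, Finite (AddCommGroup.torsion (H1 (C.space n)))) ∧
    (∃ a : ℤ_[p], Tendsto
      (fun n => (Nat.card (AddCommGroup.torsion (H1 (C.space n))) : ℤ_[p])) atTop (𝓝 a)) ∧
    (∃ a : ℤ_[p], Tendsto
      (fun n => (Nat.card (nonPTorsion (H1 (C.space n)) p) : ℤ_[p])) atTop (𝓝 a)) ∧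
    (∀ l : ℕ, l.Prime → ∃ a : ℤ_[p], Tendsto
      (fun n => (Nat.card (AddCommGroup.primaryComponent (H1 (C.space n)) l) : ℤ_[p]))
        atTop (𝓝 a)) := by
  have hp := (Fact.out (p := p.Prime))
  obtain ⟨c⟩ := C.exists_pathSystem
  obtain ⟨u, hequiv, hker⟩ := C.exists_generators
  -- The ranges of these retractions form the tower; they are preserved by deck transformations and
  -- transition maps.
  let r : ∀ n, EdgeGroup (C.space n) →+ EdgeGroup (C.space n) :=
    fun n => EdgeGroup.retraction c (C.isCoveringMap n)
  have hr : ∀ n q, q ∈ (r n).range ↔ r n q = q := fun n q =>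
    ⟨fun ⟨y, hy⟩ => by rw [← hy]; exact EdgeGroup.retraction_retraction c _ y, fun h => ⟨q, h⟩⟩
  have hfin : ∀ n, Module.Finite ℤ (r n).range := C.finite_range_retraction c
  let T : ∀ n, AddMonoid.End (EdgeGroup (C.space n)) := fun n => deckEnd (C.isCover n) (u n)
  have hTr : ∀ n q, r n (T n q) = T n (r n q) := fun n q =>
    (EdgeGroup.map_retraction c (C.isCoveringMap n) (C.isCoveringMap n)
      (comp_deckMap (C.isCover n) (u n)) q).symm
  have hfr : ∀ n q, r n (EdgeGroup.map (C.trans n) q) = EdgeGroup.map (C.trans n) (r (n + 1) q) :=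
    fun n q => (EdgeGroup.map_retraction c (C.isCoveringMap (n + 1)) (C.isCoveringMap n)
      (C.proj_trans n) q).symm
  have hTk : ∀ n k q, r n ((T n ^ k) q) = (T n ^ k) (r n q) := by
    intro n k q
    induction k with
    | zero => rfl
    | succ k ih =>
      rw [pow_succ']
      exact (hTr n _).trans (congrArg (T n) ih)
  have hTpow : ∀ n, T n ^ p ^ n = 1 := fun n => by
    rw [deckEnd_pow, nsmul_eq_mul, ZMod.natCast_self, zero_mul, ← zero_nsmul (u n),
      ← deckEnd_pow, pow_zero]
  let t : ∀ n, AddMonoid.End (r n).range := fun n =>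
    ((T n).comp (r n).range.subtype).codRestrict (r n).range fun q =>
      (hr n _).2 ((hTr n q).trans (congrArg (T n) ((hr n _).1 q.2)))
  let π : ∀ n, (r (n + 1)).range →+ (r n).range := fun n =>
    ((EdgeGroup.map (C.trans n)).comp (r (n + 1)).range.subtype).codRestrict (r n).range fun q =>
      (hr n _).2 ((hfr n q).trans (congrArg _ ((hr (n + 1) _).1 q.2)))
  have htk : ∀ n k (q : (r n).range), (((t n ^ k) q : (r n).range) : EdgeGroup (C.space n)) =
      (T n ^ k) q := by
    intro n k q
    induction k with
    | zero => rfl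
    | succ k ih =>
      rw [pow_succ', pow_succ']
      exact congrArg (T n) ih
  have hmain := tower_torsion_converges (p := p) t π
    (fun n => AddMonoidHom.ext fun q => Subtype.ext ?_) (fun n z => ?_) (fun n x => Subtype.ext ?_)
    (fun n x => ?_)
  rotate_left
  · exact (htk n _ q).trans (by rw [hTpow]; rfl)
  · obtain ⟨y, hy⟩ := EdgeGroup.map_surjective_of_covering (C.isCoveringMap (n + 1))
      (C.isCoveringMap n) (C.proj_trans n) (surjective_of_quotientCovering (C.isCover (n + 1))
        (C.isCover n) (C.proj_trans n)) (z : EdgeGroup (C.space n))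
    refine ⟨⟨r (n + 1) y, y, rfl⟩, Subtype.ext ?_⟩
    change EdgeGroup.map (C.trans n) (r (n + 1) y) = z
    rw [← hfr, hy]
    exact (hr n _).1 z.2
  · change EdgeGroup.map (C.trans n) (EdgeGroup.map _ _) = EdgeGroup.map _ (EdgeGroup.map _ _)
    rw [EdgeGroup.map_map, EdgeGroup.map_map]
    congr 1
    exact congrArg _ (ContinuousMap.ext fun w => hequiv n w)
  · have h0 : π n x = 0 ↔ EdgeGroup.map (C.trans n) x = 0 := Subtype.ext_iff
    rw [h0, hker]
    constructor
    -- The witness `y` need not lie in the range; applying the retraction, which commutes with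
    -- everything, moves it there.
    · rintro ⟨y, hy⟩
      refine ⟨⟨r (n + 1) y, y, rfl⟩, Subtype.ext ?_⟩
      rw [AddSubgroup.coe_sub, htk, ← (hr (n + 1) _).1 x.2, hy, map_sub]
      exact congrArg (· - _) (hTk (n + 1) _ y)
    · rintro ⟨y, rfl⟩
      refine ⟨y, ?_⟩
      rw [AddSubgroup.coe_sub, htk]
  have hequiv : ∀ n (P : ℕ → Prop), (∀ m, P m → m ≠ 0) →
      Nonempty (killedBy P (r n).range ≃ killedBy P (H1 (C.space n))) := by
    intro n P hP
    obtain ⟨j, hj, htor⟩ := exists_H1_to_edgeGroup (C.space n)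
    obtain ⟨e⟩ := nonempty_equiv_killedBy j hj htor P hP
    -- Torsion classes have zero boundary, so the retraction fixes them.
    obtain ⟨e'⟩ := nonempty_equiv_killedBy (r n).range.subtype Subtype.val_injective
      (fun q m hm hq => ⟨⟨q, (hr n q).2 (EdgeGroup.retraction_of_boundary_eq_zero c _
        (EdgeGroup.boundary_eq_zero_of_nsmul hm hq))⟩, rfl⟩) P hP
    exact ⟨e'.trans e.symm⟩
  have hcop : ∀ m : ℕ, m.Coprime p → m ≠ 0 := by
    rintro m hm rfl
    exact hp.one_lt.ne' ((Nat.coprime_zero_left p).1 hm)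
  have htors : ∀ n, Nonempty (AddCommGroup.torsion (r n).range ≃
      AddCommGroup.torsion (H1 (C.space n))) := fun n => by
    have := hequiv n (· ≠ 0) fun _ h => h
    rw [killedBy_ne_zero, killedBy_ne_zero] at this
    exact this
  have hnonp : ∀ n, Nonempty (nonPTorsion (r n).range p ≃ nonPTorsion (H1 (C.space n)) p) :=
    fun n => by
      have := hequiv n (fun m => m.Coprime p) hcop
      rw [killedBy_coprime, killedBy_coprime] at this
      exact this
  have hprim : ∀ n l, l.Prime → Nonempty (AddCommGroup.primaryComponent (r n).range l ≃
      AddCommGroup.primaryComponent (H1 (C.space n)) l) := fun n l hl => by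
    have := hequiv n (fun m => ∃ k, m = l ^ k) (by
      rintro _ ⟨k, rfl⟩; exact pow_ne_zero k hl.ne_zero)
    rw [killedBy_primePow, killedBy_primePow] at this
    exact this
  obtain ⟨h1, h2, h3, h4⟩ := hmain
  refine ⟨fun n => ?_, ?_, ?_, fun l hl => ?_⟩
  · obtain ⟨e⟩ := htors n
    have := h1 n
    exact Finite.of_equiv _ e
  · simpa only [fun n => Nat.card_congr (htors n).some] using h2
  · simpa only [fun n => Nat.card_congr (hnonp n).some] using h3
  · simpa only [fun n => Nat.card_congr (hprim n l hl).some] using h4 l hl
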